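/- **Proposition 4.1 (Jacobian equation).** Let $M^+$ and $M^-$ be smooth $n$-dimensional manifolds (Hausdorff, second countable) with smooth Riemannian metrics and Riemannian volumes $\mathrm{vol}_\pm$. Let $c\in C^2(M^+\times M^-)$ be non-degenerate, i.e. the matrix $D^2_{xy}c(x,y)=\big(\partial^2 c/\partial x^i\partial y^j\big)_{ij}$ of mixed second derivatives in local coordinates satisfies $\det D^2_{xy}c(x,y)\ne 0$ for all $(x,y)\in M^+\times M^-$. Let $\mu^\pm$ be Borel probability measures on $M^\pm$ that are absolutely continuous, $d\mu^\pm=f^\pm\,d\mathrm{vol}_\pm$ with $f^\pm\ge 0$. Let $\gamma$ be an optimizer of the Kantorovich problem: $\gamma$ has marginals $\mu^+$ and $\mu^-$, $c$ is $\gamma$-integrable, and $\int c\,d\gamma\le\int c\,d\gamma'$ for every measure $\gamma'$ with marginals $\mu^+,\mu^-$ for which $c$ is $\gamma'$-integrable. (If $\mu^\pm$ are compactly supported, integrability is automatic.) Assume that $\gamma$ is concentrated on the graph $\{(x,T(x)) : x\in \mathrm{dom}(T)\}$ of a map $T:\mathrm{dom}(T)\to M^-$ that is injective and continuous on a set $\mathrm{dom}(T)\subseteq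 M^+$ whose complement is $\mathrm{vol}_+$-null. Let $\mathrm{spt}(\mu^+)$ be the support of $\mu^+$ and $S=\mathrm{dom}(T)\cap \mathrm{spt}(\mu^+)$. Then: 1. For $\mathrm{vol}_+$-almost every $x\in\mathrm{spt}(\mu^+)$ (in particular for $\mu^+$-almost every $x$), the map $T|_{S}$ is differentiable at $x$ relative to $S$, its derivative $DT(x):T_xM^+\to T_{T(x)}M^-$ is uniquely determined, and $$f^+(x)=|\det DT(x)|\,f^-(T(x)).$$ 2. For $\mathrm{vol}_+$-almost every $x\in M^+$ at which $T:\mathrm{dom}(T)\to M^-$ is differentiable relative to $\mathrm{dom}(T)$, its derivative $DT(x)$ is uniquely determined and the same equation $f^+(x)=|\det DT(x)|\,f^-(T(x))$ holds. Here the determinants are taken with respect to the Riemannian metrics. In particular, if $\mathrm{spt}(\mu^+)=M^+$, then $T$ is differentiable relative to $\mathrm{dom}(T)$ and satisfies the equation at $\mathrm{vol}_+$-almost every $x\in M^+$. -/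

import Mathlib

open Set MeasureTheory Manifold
open scoped ContDiff NNReal ENNReal

noncomputable section

namespace OptimalTransport

/-- `ℝⁿ`, the model space of an `n`-dimensional manifold. -/
abbrev Model (n : ℕ) : Type := EuclideanSpace ℝ (Fin n)

section Riemannian

variable {n : ℕ} {M : Type*} [TopologicalSpace M] [ChartedSpace (Model n) M]
  [IsManifold (𝓡 n) ∞ M]

variable (n M) in
/-- Smooth Riemannian metrics on the `n`-dimensional smooth manifold `M`. -/
abbrev Metric : Type _ :=
  Bundle.ContMDiffRiemannianMetric (𝓡 n) ∞ (Model n) (fun x : M => TangentSpace (𝓡 n) x)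

/-- The `n`-dimensional volume, with respect to the inner product `g` at `x`, of the parallelepiped
spanned by the tangent vectors `v 0, …, v (n - 1)` at `x`: the square root of the determinant of the
matrix `(g (v i, v j))`. -/
def parallelepipedVolume (g : Metric n M) (x : M) (v : Fin n → TangentSpace (𝓡 n) x) : ℝ :=
  Real.sqrt (Matrix.of fun i j => g.inner x (v i) (v j)).det

/-- The `i`-th standard basis vector of the tangent space at `x`, which is a copy of `ℝⁿ`. -/
def basisVector {M : Type*} [TopologicalSpace M] [ChartedSpace (Model n) M] (x : M) (i : Fin n) :
    TangentSpace (𝓡 n) x :=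
  (EuclideanSpace.single i (1 : ℝ) : Model n)

/-- The `i`-th coordinate vector field `∂/∂zᵢ` of the chart `φ`, at the point with
coordinates `z`. -/
def coordVector (φ : OpenPartialHomeomorph M (Model n)) (z : Model n) (i : Fin n) :
    TangentSpace (𝓡 n) (φ.symm z) :=
  mfderiv (𝓡 n) (𝓡 n) φ.symm z (basisVector z i)

/-- The measure `√(det g_ij) dz` on the domain of the chart `φ`. -/
def chartVolume [MeasurableSpace M] (g : Metric n M) (φ : OpenPartialHomeomorph M (Model n)) :
    Measure M :=
  ((volume.restrict φ.target).withDensity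
    (fun z => ENNReal.ofReal (parallelepipedVolume g (φ.symm z) (coordVector φ z)))).map φ.symm

/-- The Riemannian volume measure of `g`. The measures `√(det g_ij) dz` of any two charts agree on
the intersection of the chart domains; the volume is the measure that restricts to them,
i.e. their supremum in the lattice of measures. -/
def riemannianVolume [MeasurableSpace M] (g : Metric n M) : Measure M :=
  ⨆ φ ∈ atlas (Model n) M, chartVolume g φ

/-- The absolute value `|det A|` of the determinant of a linear map `A : T_x M → T_y N` between
tangent spaces of Riemannian manifolds of the same dimension: the factor by which `A` multiplies
`n`-dimensional volume, computed on the parallelepiped spanned by a basis of `T_x M`. -/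
def absDet {N : Type*} [TopologicalSpace N] [ChartedSpace (Model n) N] [IsManifold (𝓡 n) ∞ N]
    (g : Metric n M) (h : Metric n N) (x : M) (y : N)
    (A : TangentSpace (𝓡 n) x →L[ℝ] TangentSpace (𝓡 n) y) : ℝ :=
  parallelepipedVolume h y (fun i => A (basisVector x i)) /
    parallelepipedVolume g x (basisVector x)

end Riemannian

section Cost

variable {n : ℕ} {M N : Type*} [TopologicalSpace M] [ChartedSpace (Model n) M]
  [TopologicalSpace N] [ChartedSpace (Model n) N]

/-- The matrix `D²_xy c (x₀, y₀)` of mixed second order partial derivatives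
`∂²c / ∂xⁱ∂yʲ`, in the coordinates given by the preferred charts around `x₀` and `y₀`. -/
def mixedHessian (c : M × N → ℝ) (x₀ : M) (y₀ : N) : Matrix (Fin n) (Fin n) ℝ :=
  let φ := chartAt (Model n) x₀
  let ψ := chartAt (Model n) y₀
  Matrix.of fun i j =>
    fderiv ℝ (fun v : Model n =>
        fderiv ℝ (fun u : Model n => c (φ.symm u, ψ.symm v)) (φ x₀) (EuclideanSpace.single i 1))
      (ψ y₀) (EuclideanSpace.single j 1)

variable (n) in
/-- The cost `c` is non-degenerate at `(x₀, y₀)`: `det D²_xy c (x₀, y₀) ≠ 0`. (For a `C²` cost this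
does not depend on the coordinates.) -/
def NondegenerateAt (c : M × N → ℝ) (x₀ : M) (y₀ : N) : Prop :=
  (mixedHessian (n := n) c x₀ y₀).det ≠ 0

end Cost

section Kantorovich

variable {X Y : Type*} [MeasurableSpace X] [MeasurableSpace Y]

/-- `γ` has marginals `μ` and `ν`. -/
structure IsCoupling (μ : Measure X) (ν : Measure Y) (γ : Measure (X × Y)) : Prop where
  map_fst : γ.map Prod.fst = μ
  map_snd : γ.map Prod.snd = ν

/-- `γ` solves the Kantorovich problem: it has finite total cost, and it minimizes the total cost
among the measures with marginals `μ` and `ν`. (If `c` is continuous and `μ`, `ν` are compactly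
supported probability measures then `c` is integrable with respect to every coupling.) -/
structure IsOptimal (c : X × Y → ℝ) (μ : Measure X) (ν : Measure Y) (γ : Measure (X × Y)) :
    Prop where
  coupling : IsCoupling μ ν γ
  integrable : Integrable c γ
  minimal : ∀ γ' : Measure (X × Y), IsCoupling μ ν γ' → Integrable c γ' →
    ∫ p, c p ∂γ ≤ ∫ p, c p ∂γ'

end Kantorovich

end OptimalTransport

end

/-!
# The Jacobian equation for optimal transportation with a non-degenerate cost

Two independent facts are combined.

*Differentiability.* An optimizer `γ` is concentrated on the graph of `T`, so by continuity of `T`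
the points `(x, T x)` with `x ∈ D ∩ μ.support` lie in `γ.support`, and exchanging a little mass
between two points of `γ.support` shows that
`c (x, T x) + c (x', T x') ≤ c (x, T x') + c (x', T x)` there (`IsOptimal.two_monotone`). In
coordinates near a given point the mixed Hessian of `c` is close to a fixed invertible bilinear
form; after a linear change `A` of the target variable this form is `-⟪·, ·⟫`, and the inequality
says that `(u, A v)` ranges over an almost monotone set. Hence `u` is a Lipschitz function of
`u + A v` (`exists_dist_le_of_nondegenerate`), as in Minty's parametrization of monotone graphs.
So `P u = u + A (T u)` has a Lipschitz inverse `X`. By Rademacher's theorem and Sard's lemma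
almost every `u` is the image under `X` of a point where `X` has an invertible derivative, and there
`P`, hence `T`, is differentiable relative to its domain
(`ae_differentiableWithinAt_of_antilipschitz`).

*The equation.* Since `T` is injective, `μ A = ν (T '' A)` (`IsCoupling.measure_image_eq`).
The set where `T` is differentiable relative to its domain is covered, in coordinates, by countably
many Borel sets on which `T` is Lipschitz (`exists_lipschitz_cover`); on each of them the change of
variables formula turns `μ A = ν (T '' A)` into an equality of integrals over arbitrary Borel sets
`A`, thus into an almost everywhere equality of densities (`ae_density_eq_of_image`). Almost every
point of a set is a Lebesgue density point, where derivatives relative to the set are unique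
(`ae_uniqueDiffWithinAt`). The passage between the manifold and its charts rests on the fact that
the volume restricts to `√(det g_ij) dz` in every chart of the atlas
(`riemannianVolume_restrict_source`). Both assertions of the theorem are instances of `ae_jacobian`,
for the relative domains `D ∩ μ.support` and `D`.
-/

namespace OptimalTransport

open Filter Topology

/-! ### Differentiability relative to subsets of a Euclidean space -/

theorem measurableSet_inter_preimage {X Y : Type*} [TopologicalSpace X] [MeasurableSpace X]
    [OpensMeasurableSpace X] [TopologicalSpace Y] [MeasurableSpace Y] [BorelSpace Y]
    {f : X → Y} {s : Set X} {t : Set Y} (hf : ContinuousOn f s) (hs : MeasurableSet s)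
    (ht : MeasurableSet t) : MeasurableSet (s ∩ f ⁻¹' t) := by
  have h := hs.subtype_image (hf.domRestrict.measurable ht)
  convert h using 1
  ext x
  simp [Set.domRestrict, and_comm]

section Euclidean

variable {E : Type*} [NormedAddCommGroup E] [NormedSpace ℝ E] [FiniteDimensional ℝ E]
  [MeasurableSpace E] [BorelSpace E] (m : Measure E) [m.IsAddHaarMeasure]

/-- At a Lebesgue density point of `s` every vector is tangent to `s`: each small ball around `v`,
scaled down and moved to `x`, meets `s`. -/
theorem uniqueDiffWithinAt_of_density_one {s : Set E} {x : E}
    (h : Tendsto (fun r => m (s ∩ Metric.closedBall x r) / m (Metric.closedBall x r))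
      (𝓝[>] 0) (𝓝 1)) : UniqueDiffWithinAt ℝ s x := by
  have key : ∀ v : E, v ∈ tangentConeAt ℝ s x := by
    intro v
    have step : ∀ k : ℕ, ∃ r : ℝ, ∃ w : E, 0 < r ∧ r < 1 / ((k : ℝ) + 1) ∧
        w ∈ Metric.closedBall v (1 / ((k : ℝ) + 1)) ∧ x + r • w ∈ s := by
      intro k
      have hk : (0 : ℝ) < 1 / ((k : ℝ) + 1) := by positivity
      have h1 := Measure.eventually_nonempty_inter_smul_of_density_one m s x h
        (Metric.closedBall v (1 / ((k : ℝ) + 1))) measurableSet_closedBall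
        (Metric.measure_closedBall_pos m v hk).ne'
      have h2 : ∀ᶠ r : ℝ in 𝓝[>] (0 : ℝ), r ∈ Ioo (0 : ℝ) (1 / ((k : ℝ) + 1)) :=
        Ioo_mem_nhdsGT hk
      obtain ⟨r, ⟨y, hys, hy⟩, hr⟩ := (h1.and h2).exists
      obtain ⟨w, hw, rfl⟩ : ∃ w ∈ Metric.closedBall v (1 / ((k : ℝ) + 1)), x + r • w = y := by
        obtain ⟨w, hw, hwy⟩ : ∃ w, dist w v ≤ ((k : ℝ) + 1)⁻¹ ∧ r • w = -x + y := by
          simpa [Set.mem_smul_set] using hy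
        exact ⟨w, by simpa using hw, by rw [hwy, add_neg_cancel_left]⟩
      exact ⟨r, w, hr.1, hr.2, hw, hys⟩
    choose r w hr0 hr1 hw hs using step
    have hlim := tendsto_one_div_add_atTop_nhds_zero_nat (𝕜 := ℝ)
    have hwv : Tendsto w atTop (𝓝 v) := by
      rw [tendsto_iff_dist_tendsto_zero]
      exact squeeze_zero (fun _ => dist_nonneg) (fun k => Metric.mem_closedBall.1 (hw k)) hlim
    have hr : Tendsto r atTop (𝓝 0) :=
      squeeze_zero (fun k => (hr0 k).le) (fun k => (hr1 k).le) hlim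
    refine mem_tangentConeAt_of_seq atTop (fun k => (r k)⁻¹) (fun k => r k • w k) ?_
      (Eventually.of_forall hs) ?_
    · simpa using hr.smul hwv
    · refine hwv.congr fun k => ?_
      rw [smul_smul, inv_mul_cancel₀ (hr0 k).ne', one_smul]
  refine ⟨?_, ?_⟩
  · rw [eq_univ_of_forall key]
    simp
  · exact mem_closure_of_nonempty_tangentConeAt ⟨0, key 0⟩

theorem ae_uniqueDiffWithinAt (s : Set E) : ∀ᵐ x ∂m, x ∈ s → UniqueDiffWithinAt ℝ s x :=
  (ae_imp_of_ae_restrict (Besicovitch.ae_tendsto_measure_inter_div m s)).mono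
    fun _ hx hxs => uniqueDiffWithinAt_of_density_one m (hx hxs)

theorem measure_image_eq_zero_of_lipschitz {f : E → E} {K : ℝ≥0} (hf : LipschitzWith K f)
    {s : Set E} (hs : m s = 0) : m (f '' s) = 0 := by
  have h1 : m ≪ μH[Module.finrank ℝ E] := Measure.absolutelyContinuous_isAddHaarMeasure _ _
  have h2 : (μH[Module.finrank ℝ E] : Measure E) ≪ m :=
    Measure.absolutelyContinuous_isAddHaarMeasure _ _
  apply h1
  have := hf.hausdorffMeasure_image_le (d := Module.finrank ℝ E) (by positivity) s
  rw [h2 hs, mul_zero] at this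
  exact le_antisymm this bot_le

/-- A continuous map of a set which does not contract distances by more than a fixed factor is
differentiable almost everywhere on the set, although it need not be Lipschitz. Its inverse is
Lipschitz; the images of the points where the inverse is not differentiable, or has a singular
derivative, are negligible by Rademacher's theorem and Sard's lemma. -/
theorem ae_differentiableWithinAt_of_antilipschitz {W : Set E} {P : E → E} {K : ℝ≥0}
    (hP : ContinuousOn P W) (hK : ∀ z ∈ W, ∀ z' ∈ W, dist z z' ≤ K * dist (P z) (P z')) :
    ∀ᵐ z ∂m, z ∈ W → DifferentiableWithinAt ℝ P W z := by
  have hinj : InjOn P W := by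
    intro z hz z' hz' h
    have := hK z hz z' hz'
    rw [h, dist_self, mul_zero] at this
    exact dist_le_zero.1 this
  have hX : LipschitzOnWith K (Function.invFunOn P W) (P '' W) := by
    apply LipschitzOnWith.of_dist_le_mul
    rintro _ ⟨z, hz, rfl⟩ _ ⟨z', hz', rfl⟩
    rw [hinj.leftInvOn_invFunOn hz, hinj.leftInvOn_invFunOn hz']
    exact hK z hz z' hz'
  obtain ⟨X, hXL, hXe⟩ := hX.extend_finite_dimension
  have hXP : ∀ z ∈ W, X (P z) = z := fun z hz => by
    rw [← hXe (mem_image_of_mem P hz), hinj.leftInvOn_invFunOn hz]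
  have hN1 : m (X '' {p | ¬ DifferentiableAt ℝ X p}) = 0 :=
    measure_image_eq_zero_of_lipschitz m hXL hXL.ae_differentiableAt
  have hN2 : m (X '' {p | DifferentiableAt ℝ X p ∧ (fderiv ℝ X p).det = 0}) = 0 :=
    addHaar_image_eq_zero_of_det_fderivWithin_eq_zero m (f' := fderiv ℝ X)
      (fun p hp => hp.1.hasFDerivAt.hasFDerivWithinAt) (fun p hp => hp.2)
  filter_upwards [measure_eq_zero_iff_ae_notMem.1 hN1, measure_eq_zero_iff_ae_notMem.1 hN2]
    with z h1 h2 hz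
  have hd : DifferentiableAt ℝ X (P z) := by
    by_contra h
    exact h1 ⟨P z, h, hXP z hz⟩
  have hdet : (fderiv ℝ X (P z)).det ≠ 0 := fun h => h2 ⟨P z, ⟨hd, h⟩, hXP z hz⟩
  have hfd : HasFDerivWithinAt X
      (((fderiv ℝ X (P z)).toContinuousLinearEquivOfDetNeZero hdet : E ≃L[ℝ] E) : E →L[ℝ] E)
      univ (P z) := by
    have h3 : (((fderiv ℝ X (P z)).toContinuousLinearEquivOfDetNeZero hdet : E ≃L[ℝ] E) :
        E →L[ℝ] E) = fderiv ℝ X (P z) := by ext; rfl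
    rw [h3]
    exact hd.hasFDerivAt.hasFDerivWithinAt
  refine (HasFDerivWithinAt.of_local_left_inverse (t := univ) ?_ hfd hz ?_).differentiableWithinAt
  · rw [nhdsWithin_univ]
    exact hP z hz
  · exact eventually_nhdsWithin_of_forall hXP

/-- The points where a continuous map `t` on a Borel set `W` is differentiable relative to `W` are
covered by countably many Borel subsets of `W` on which `t` is Lipschitz, so that the measurability
of the set of these points is not an issue. A Lipschitz bound on any subset of `W` extends by continuity to the relative
closure of that subset, which is Borel. -/
theorem exists_lipschitz_cover {W : Set E} (hW : MeasurableSet W) {t : E → E}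
    (ht : ContinuousOn t W) :
    ∃ Q : ℕ → Set E, (∀ k, MeasurableSet (Q k)) ∧ (∀ k, Q k ⊆ W) ∧
      {z ∈ W | DifferentiableWithinAt ℝ t W z} ⊆ ⋃ k, Q k ∧
      ∀ k, ∃ K : ℝ≥0, LipschitzOnWith K t (Q k) := by
  set P : Set E := {z ∈ W | DifferentiableWithinAt ℝ t W z}
  obtain ⟨c, A, -, -, hc, hA, -⟩ := exists_partition_approximatesLinearOn_of_hasFDerivWithinAt
    t P (fun z => fderivWithin ℝ t W z)
    (fun z hz => hz.2.hasFDerivWithinAt.mono (fun _ h => h.1)) (fun _ => 1) (fun _ => one_ne_zero)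
  refine ⟨fun k => W ∩ closure (P ∩ c k), fun k => hW.inter isClosed_closure.measurableSet,
    fun k => inter_subset_left, fun z hz => ?_, fun k => ⟨‖A k‖₊ + 1, ?_⟩⟩
  · obtain ⟨k, hk⟩ := mem_iUnion.1 (hc hz)
    exact mem_iUnion.2 ⟨k, hz.1, subset_closure ⟨hz, hk⟩⟩
  · have hL : LipschitzOnWith (‖A k‖₊ + 1) t (P ∩ c k) :=
      lipschitzOnWith_iff_restrict.2 (hA k).lipschitz
    apply LipschitzOnWith.of_dist_le_mul
    rintro z ⟨hzW, hz⟩ z' ⟨hzW', hz'⟩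
    have := mem_closure_iff_nhdsWithin_neBot.1 hz
    have := mem_closure_iff_nhdsWithin_neBot.1 hz'
    have hsub : P ∩ c k ⊆ W := fun _ h => h.1.1
    have e1 : Tendsto t (𝓝[P ∩ c k] z) (𝓝 (t z)) := (ht z hzW).mono_left (nhdsWithin_mono _ hsub)
    have e2 : Tendsto t (𝓝[P ∩ c k] z') (𝓝 (t z')) :=
      (ht z' hzW').mono_left (nhdsWithin_mono _ hsub)
    have i1 : Tendsto id (𝓝[P ∩ c k] z) (𝓝 z) := tendsto_id.mono_left nhdsWithin_le_nhds
    have i2 : Tendsto id (𝓝[P ∩ c k] z') (𝓝 z') := tendsto_id.mono_left nhdsWithin_le_nhds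
    refine le_of_tendsto_of_tendsto
      ((e1.comp tendsto_fst).dist (e2.comp tendsto_snd))
      (((i1.comp tendsto_fst).dist (i2.comp tendsto_snd)).const_mul _) ?_
    filter_upwards [prod_mem_prod self_mem_nhdsWithin self_mem_nhdsWithin] with p hp
    exact hL.dist_le_mul _ hp.1 _ hp.2

/-- If `t` pushes the density `F₁` on `C` to the density `F₂` on its image, then
`F₁ = |det t'| * F₂ ∘ t` almost everywhere on `C`. As `F₂` is only almost everywhere measurable,
it is first replaced by a measurable representative `G`. -/
theorem ae_density_eq_of_image {C V : Set E} (hC : MeasurableSet C) (hV : MeasurableSet V)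
    {t : E → E} {t' : E → E →L[ℝ] E} (ht' : ∀ z ∈ C, HasFDerivWithinAt t (t' z) C z)
    (hinj : InjOn t C) (hCV : MapsTo t C V) {F₁ F₂ : E → ℝ≥0∞}
    (hF₁ : AEMeasurable F₁ (m.restrict C)) (hF₂ : AEMeasurable F₂ (m.restrict V))
    (hfin : ∫⁻ z in C, F₁ z ∂m ≠ ⊤)
    (heq : ∀ A ⊆ C, MeasurableSet A → ∫⁻ z in A, F₁ z ∂m = ∫⁻ w in t '' A, F₂ w ∂m) :
    ∀ᵐ z ∂m, z ∈ C → F₁ z = ENNReal.ofReal |(t' z).det| * F₂ (t z) := by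
  have htc : ContinuousOn t C := fun z hz => (ht' z hz).continuousWithinAt
  have hJ : AEMeasurable (fun z => ENNReal.ofReal |(t' z).det|) (m.restrict C) :=
    aemeasurable_ofReal_abs_det_fderivWithin m hC ht'
  obtain ⟨G, hG, hFG⟩ := hF₂
  have hGt : AEMeasurable (fun z => G (t z)) (m.restrict C) :=
    hG.comp_aemeasurable (htc.aemeasurable hC)
  -- The null set where `F₂` and `G` differ pulls back to a set which may have positive measure,
  -- but where `det t' = 0` almost everywhere.
  obtain ⟨Z, hZsub, hZ, hZ0⟩ :=
    exists_measurable_superset_of_null (ae_iff.1 ((ae_restrict_iff' hV).1 hFG))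
  have hCZ : MeasurableSet (C ∩ t ⁻¹' Z) := measurableSet_inter_preimage htc hC hZ
  have hdet0 : ∀ᵐ z ∂m, z ∈ C ∩ t ⁻¹' Z → ENNReal.ofReal |(t' z).det| = 0 := by
    have h1 : ∫⁻ z in C ∩ t ⁻¹' Z, ENNReal.ofReal |(t' z).det| ∂m = 0 := by
      rw [lintegral_abs_det_fderiv_eq_addHaar_image m hCZ
        (fun z hz => (ht' z hz.1).mono inter_subset_left) (hinj.mono inter_subset_left)]
      exact measure_mono_null (by rintro _ ⟨z, hz, rfl⟩; exact hz.2) hZ0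
    rw [lintegral_eq_zero_iff' (hJ.mono_measure (Measure.restrict_mono inter_subset_left le_rfl))]
      at h1
    exact (ae_restrict_iff' hCZ).1 h1
  have hrep : ∀ᵐ z ∂m, z ∈ C →
      ENNReal.ofReal |(t' z).det| * G (t z) = ENNReal.ofReal |(t' z).det| * F₂ (t z) := by
    filter_upwards [hdet0] with z hz hzC
    by_cases hzZ : t z ∈ Z
    · rw [hz ⟨hzC, hzZ⟩, zero_mul, zero_mul]
    · have : F₂ (t z) = G (t z) := by
        by_contra h
        exact hzZ (hZsub fun h' => h (h' (hCV hzC)))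
      rw [this]
  have hint : ∀ A ⊆ C, MeasurableSet A →
      ∫⁻ z in A, F₁ z ∂m = ∫⁻ z in A, ENNReal.ofReal |(t' z).det| * G (t z) ∂m := by
    intro A hAC hA
    rw [heq A hAC hA, lintegral_image_eq_lintegral_abs_det_fderiv_mul m hA
      (fun z hz => (ht' z (hAC hz)).mono hAC) (hinj.mono hAC)]
    refine lintegral_congr_ae ((ae_restrict_iff' hA).2 ?_)
    filter_upwards [hrep] with z hz hzA using (hz (hAC hzA)).symm
  have hae : F₁ =ᵐ[m.restrict C] fun z => ENNReal.ofReal |(t' z).det| * G (t z) := by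
    refine AEMeasurable.ae_eq_of_forall_setLIntegral_eq hF₁ (hJ.mul hGt) hfin ?_ ?_
    · rw [← hint C subset_rfl hC]
      exact hfin
    · intro A hA _
      rw [Measure.restrict_restrict hA]
      exact hint _ inter_subset_right (hA.inter hC)
  filter_upwards [(ae_restrict_iff' hC).1 hae, hrep] with z h1 h2 hz
  rw [h1 hz, h2 hz]

end Euclidean

/-! ### The Riemannian volume in charts -/

section Volume

theorem measurableSet_symm_image {M : Type*} [TopologicalSpace M] [MeasurableSpace M]
    [BorelSpace M] {n : ℕ}
    (φ : OpenPartialHomeomorph M (Model n)) {B : Set (Model n)} (hB : MeasurableSet B)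
    (hBφ : B ⊆ φ.target) : MeasurableSet (φ.symm '' B) := by
  rw [φ.symm.image_eq_target_inter_inv_preimage hBφ]
  exact measurableSet_inter_preimage φ.continuousOn φ.open_source.measurableSet hB

theorem measurableSet_image {M : Type*} [TopologicalSpace M] [MeasurableSpace M]
    [BorelSpace M] {n : ℕ}
    (φ : OpenPartialHomeomorph M (Model n)) {A : Set M} (hA : MeasurableSet A)
    (hAφ : A ⊆ φ.source) : MeasurableSet (φ '' A) := by
  rw [φ.image_eq_target_inter_inv_preimage hAφ]
  exact measurableSet_inter_preimage φ.continuousOn_symm φ.open_target.measurableSet hA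

variable {n : ℕ} {M : Type*} [TopologicalSpace M] [ChartedSpace (Model n) M]
  [IsManifold (𝓡 n) ∞ M]

/-- The Gram matrix of the images under `B ∘ L` of the standard basis is `Lᵀ G L`, where `G` is the
Gram matrix of their images under `B`. -/
theorem parallelepipedVolume_comp (g : Metric n M) (x : M)
    (B : Model n →L[ℝ] TangentSpace (𝓡 n) x) (L : Model n →L[ℝ] Model n) :
    parallelepipedVolume g x (fun i => B (L (EuclideanSpace.single i 1))) =
      |L.det| * parallelepipedVolume g x (fun i => B (EuclideanSpace.single i 1)) := by
  classical
  set b := (EuclideanSpace.basisFun (Fin n) ℝ).toBasis with hb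
  have hbi : ∀ i, b i = EuclideanSpace.single i (1 : ℝ) := fun i => by simp [hb]
  set A : Matrix (Fin n) (Fin n) ℝ := LinearMap.toMatrix b b (L : Model n →ₗ[ℝ] Model n) with hA
  have hLe : ∀ i, L (EuclideanSpace.single i 1) = ∑ k, A k i • EuclideanSpace.single k (1 : ℝ) := by
    intro i
    rw [← b.sum_repr (L (EuclideanSpace.single i 1))]
    refine Finset.sum_congr rfl fun k _ => ?_
    rw [hbi, hA, LinearMap.toMatrix_apply, hbi]
    rfl
  have hdet : L.det = A.det := by
    rw [hA, LinearMap.det_toMatrix]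
  have hG : (Matrix.of fun i j => g.inner x (B (L (EuclideanSpace.single i 1)))
        (B (L (EuclideanSpace.single j 1)))) =
      A.transpose * (Matrix.of fun i j => g.inner x (B (EuclideanSpace.single i 1))
        (B (EuclideanSpace.single j 1))) * A := by
    ext i j
    simp only [Matrix.of_apply, Matrix.mul_apply, Matrix.transpose_apply, hLe, map_sum, map_smul,
      sum_apply, smul_apply, smul_eq_mul]
    refine Finset.sum_congr rfl fun k _ => ?_
    rw [Finset.sum_mul, Finset.mul_sum]
    refine Finset.sum_congr rfl fun l _ => ?_
    ring
  unfold parallelepipedVolume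
  rw [hG, Matrix.det_mul, Matrix.det_mul, Matrix.det_transpose, hdet, ← Real.sqrt_sq_eq_abs,
    ← Real.sqrt_mul (sq_nonneg _)]
  congr 1
  ring

theorem parallelepipedVolume_pos (g : Metric n M) (x : M)
    (B : Model n →L[ℝ] TangentSpace (𝓡 n) x) (hB : Function.Injective B) :
    0 < parallelepipedVolume g x (fun i => B (EuclideanSpace.single i 1)) := by
  classical
  have : (Matrix.of fun i j => g.inner x (B (EuclideanSpace.single i 1))
        (B (EuclideanSpace.single j (1 : ℝ)))).PosDef := by
    refine Matrix.PosDef.of_dotProduct_mulVec_pos ?_ ?_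
    · ext i j
      simp [g.symm x (B (EuclideanSpace.single i 1))]
    · intro v hv
      have hne : B (WithLp.toLp 2 v) ≠ 0 := by
        intro h
        have := hB (h.trans (map_zero B).symm)
        exact hv (by simpa using this)
      have hsum : (WithLp.toLp 2 v : Model n) = ∑ i, v i • EuclideanSpace.single i (1 : ℝ) := by
        ext j
        simp [Finset.sum_apply, Pi.single_apply]
      have := g.pos x _ hne
      rw [hsum] at this
      simp only [map_sum, map_smul, sum_apply, smul_apply,
        smul_eq_mul, Finset.mul_sum] at this
      simp only [dotProduct, Matrix.mulVec, Matrix.of_apply, Finset.mul_sum, star_trivial]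
      rw [Finset.sum_comm]
      refine this.trans_eq (Finset.sum_congr rfl fun i _ => Finset.sum_congr rfl fun j _ => ?_)
      ring
  exact Real.sqrt_pos.2 this.det_pos

/-- The density `√(det g_ij)` of the Riemannian volume in the coordinates of the chart `φ`, at the
point with coordinates `z`. It is meaningful only for `z ∈ φ.target`. -/
noncomputable def chartDensity (g : Metric n M) (φ : OpenPartialHomeomorph M (Model n))
    (z : Model n) : ℝ≥0∞ :=
  ENNReal.ofReal (parallelepipedVolume g (φ.symm z) (coordVector φ z))

theorem continuousOn_parallelepipedVolume_coordVector (g : Metric n M)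
    {φ : OpenPartialHomeomorph M (Model n)} (hφ : φ ∈ atlas (Model n) M) :
    ContinuousOn (fun z => parallelepipedVolume g (φ.symm z) (coordVector φ z)) φ.target := by
  have hsymm : ContMDiffOn (𝓡 n) (𝓡 n) ∞ φ.symm φ.target :=
    contMDiffOn_symm_of_mem_maximalAtlas (IsManifold.subset_maximalAtlas hφ)
  have hvec : ∀ i, ContinuousOn (fun z => (Bundle.TotalSpace.mk' (Model n) (φ.symm z)
      (coordVector φ z i) : TangentBundle (𝓡 n) M)) φ.target := by
    intro i
    have h1 := hsymm.continuousOn_tangentMapWithin (by simp) φ.open_target.uniqueMDiffOn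
    have h2 : Continuous (fun z : Model n =>
        (Bundle.TotalSpace.mk' (Model n) z (basisVector z i) : TangentBundle (𝓡 n) (Model n))) := by
      have := (tangentBundleModelSpaceHomeomorph (𝓡 n)).symm.continuous.comp
        (Continuous.prodMk continuous_id
          (continuous_const (y := (EuclideanSpace.single i (1 : ℝ) : Model n))))
      exact this
    have h3 := h1.comp h2.continuousOn (s := φ.target) (fun z hz => hz)
    refine h3.congr fun z hz => ?_
    simp only [Function.comp, tangentMapWithin]
    rw [mfderivWithin_of_isOpen φ.open_target hz]
    rfl
  have hent : ∀ i j, ContinuousOn (fun z => g.inner (φ.symm z) (coordVector φ z i)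
      (coordVector φ z j)) φ.target := by
    intro i j
    have hg : ContinuousOn (fun z => Bundle.TotalSpace.mk' (Model n →L[ℝ] Model n →L[ℝ] ℝ)
        (E := fun x : M => TangentSpace (𝓡 n) x →L[ℝ] TangentSpace (𝓡 n) x →L[ℝ]
          Bundle.Trivial M ℝ x)
        (φ.symm z) (g.inner (φ.symm z))) φ.target :=
      g.contMDiff.continuous.comp_continuousOn φ.continuousOn_symm
    have h := hg.clm_bundle_apply₂ (hvec i) (hvec j)
    intro z hz
    have h' := h z hz
    simp only [FiberBundle.continuousWithinAt_totalSpace] at h'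
    exact h'.2
  refine Real.continuous_sqrt.comp_continuousOn ?_
  have hdet : Continuous (fun A : Matrix (Fin n) (Fin n) ℝ => A.det) :=
    continuous_id.matrix_det
  refine hdet.comp_continuousOn ?_
  refine continuousOn_pi.2 fun i => continuousOn_pi.2 fun j => hent i j


/-- The densities of the volume in two charts differ by the Jacobian of the transition map. -/
theorem chartDensity_eq (g : Metric n M) {φ ψ : OpenPartialHomeomorph M (Model n)}
    (hφ : φ ∈ atlas (Model n) M) (hψ : ψ ∈ atlas (Model n) M) {z : Model n} (hz : z ∈ φ.target)
    (hzψ : φ.symm z ∈ ψ.source) :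
    ∃ τ' : Model n →L[ℝ] Model n, HasFDerivAt (ψ ∘ φ.symm) τ' z ∧
      chartDensity g φ z =
        ENNReal.ofReal |τ'.det| * chartDensity g ψ (ψ (φ.symm z)) := by
  have h1 : HasMFDerivAt (𝓡 n) (𝓡 n) φ.symm z (mfderiv (𝓡 n) (𝓡 n) φ.symm z) :=
    (mdifferentiableAt_atlas_symm hφ hz).hasMFDerivAt
  have h2 : HasMFDerivAt (𝓡 n) (𝓡 n) ψ (φ.symm z) (mfderiv (𝓡 n) (𝓡 n) ψ (φ.symm z)) :=
    (mdifferentiableAt_atlas hψ hzψ).hasMFDerivAt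
  have h3 := h2.comp z h1
  let Φ : Model n →L[ℝ] Model n := mfderiv (𝓡 n) (𝓡 n) φ.symm z
  let Ψ : Model n →L[ℝ] Model n := mfderiv (𝓡 n) (𝓡 n) ψ.symm (ψ (φ.symm z))
  let τ' : Model n →L[ℝ] Model n :=
    (mfderiv (𝓡 n) (𝓡 n) ψ (φ.symm z)).comp (mfderiv (𝓡 n) (𝓡 n) φ.symm z)
  refine ⟨τ', hasMFDerivAt_iff_hasFDerivAt.1 h3, ?_⟩
  have h4 : HasMFDerivAt (𝓡 n) (𝓡 n) ψ.symm (ψ (φ.symm z))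
      (mfderiv (𝓡 n) (𝓡 n) ψ.symm (ψ (φ.symm z))) :=
    (mdifferentiableAt_atlas_symm hψ (ψ.map_source hzψ)).hasMFDerivAt
  have h5 := HasMFDerivAt.comp z h4 h3
  have h6 : (ψ.symm ∘ ψ ∘ φ.symm) =ᶠ[𝓝 z] φ.symm := by
    filter_upwards [φ.symm.continuousAt hz (ψ.open_source.mem_nhds hzψ)] with y hy
    exact ψ.left_inv hy
  have h7 : Φ = Ψ.comp τ' := hasMFDerivAt_unique h1 (h5.congr_of_eventuallyEq h6.symm)
  -- both densities are computed in the tangent space at `φ.symm z`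
  have h8 : ∀ x : M, x = φ.symm z → ∀ v : Fin n → Model n,
      parallelepipedVolume g x v = parallelepipedVolume g (φ.symm z) v := by
    rintro x rfl v; rfl
  have e1 : parallelepipedVolume g (φ.symm z) (coordVector φ z) =
      parallelepipedVolume g (φ.symm z) (fun i => (Ψ (τ' (EuclideanSpace.single i 1)))) :=
    congrArg (fun A : Model n →L[ℝ] Model n => parallelepipedVolume g (φ.symm z)
      (fun i => A (EuclideanSpace.single i 1))) h7
  have e2 : parallelepipedVolume g (ψ.symm (ψ (φ.symm z))) (coordVector ψ (ψ (φ.symm z))) =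
      parallelepipedVolume g (φ.symm z) (fun i => Ψ (EuclideanSpace.single i 1)) :=
    h8 _ (ψ.left_inv hzψ) _
  have e3 : parallelepipedVolume g (φ.symm z) (fun i => (Ψ (τ' (EuclideanSpace.single i 1)))) =
      |τ'.det| * parallelepipedVolume g (φ.symm z) (fun i => Ψ (EuclideanSpace.single i 1)) :=
    parallelepipedVolume_comp g (φ.symm z) Ψ τ'
  unfold chartDensity
  rw [← ENNReal.ofReal_mul (abs_nonneg _), e1, e2, e3]

theorem chartDensity_ne_zero (g : Metric n M) {φ : OpenPartialHomeomorph M (Model n)}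
    (hφ : φ ∈ atlas (Model n) M) {z : Model n} (hz : z ∈ φ.target) : chartDensity g φ z ≠ 0 := by
  refine (ENNReal.ofReal_pos.2 (parallelepipedVolume_pos g (φ.symm z)
    (mfderiv (𝓡 n) (𝓡 n) φ.symm z) ?_)).ne'
  exact (mdifferentiable_of_mem_atlas (I := 𝓡 n) hφ).symm.mfderiv_injective hz

theorem aemeasurable_chartDensity (g : Metric n M) {φ : OpenPartialHomeomorph M (Model n)}
    (hφ : φ ∈ atlas (Model n) M) :
    AEMeasurable (chartDensity g φ) (volume.restrict φ.target) :=
  ((continuousOn_parallelepipedVolume_coordVector g hφ).aemeasurable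
    φ.open_target.measurableSet).ennreal_ofReal

variable [MeasurableSpace M] [BorelSpace M]

theorem aemeasurable_symm (g : Metric n M) (φ : OpenPartialHomeomorph M (Model n)) :
    AEMeasurable φ.symm ((volume.restrict φ.target).withDensity (chartDensity g φ)) :=
  (φ.continuousOn_symm.aemeasurable φ.open_target.measurableSet).mono_ac
    (withDensity_absolutelyContinuous _ _)

theorem chartVolume_apply (g : Metric n M) (φ : OpenPartialHomeomorph M (Model n)) {A : Set M}
    (hA : MeasurableSet A) :
    chartVolume g φ A = ∫⁻ z in φ '' (φ.source ∩ A), chartDensity g φ z := by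
  have h : φ '' (φ.source ∩ A) = φ.symm ⁻¹' A ∩ φ.target := by
    rw [φ.image_source_inter_eq', inter_comm]
  change (((volume.restrict φ.target).withDensity (chartDensity g φ)).map φ.symm) A = _
  rw [Measure.map_apply_of_aemeasurable (aemeasurable_symm g φ) hA, withDensity_apply', h,
    Measure.restrict_restrict' φ.open_target.measurableSet]

theorem chartVolume_eq (g : Metric n M) {φ ψ : OpenPartialHomeomorph M (Model n)}
    (hφ : φ ∈ atlas (Model n) M) (hψ : ψ ∈ atlas (Model n) M) {A : Set M} (hA : MeasurableSet A)
    (hAφ : A ⊆ φ.source) (hAψ : A ⊆ ψ.source) : chartVolume g φ A = chartVolume g ψ A := by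
  rw [chartVolume_apply g φ hA, chartVolume_apply g ψ hA, inter_eq_self_of_subset_right hAφ,
    inter_eq_self_of_subset_right hAψ]
  have hmem : ∀ z ∈ φ '' A, z ∈ φ.target ∧ φ.symm z ∈ A := by
    rintro _ ⟨x, hx, rfl⟩
    exact ⟨φ.map_source (hAφ hx), by rwa [φ.left_inv (hAφ hx)]⟩
  have him : ψ '' A = (ψ ∘ φ.symm) '' (φ '' A) := by
    have h : φ.symm '' (φ '' A) = A := φ.toPartialEquiv.symm_image_image_of_subset_source hAφ
    rw [image_comp, h]
  have hex := fun z : φ '' A =>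
    chartDensity_eq g hφ hψ (hmem z z.2).1 (hAψ (hmem z z.2).2)
  choose! τ' hτ' hρ using hex
  let τ : Model n → Model n →L[ℝ] Model n := fun z => fderiv ℝ (ψ ∘ φ.symm) z
  have hinj : InjOn (ψ ∘ φ.symm) (φ '' A) := by
    intro z hz w hw h
    have h1 := ψ.injOn (hAψ (hmem z hz).2) (hAψ (hmem w hw).2) h
    exact φ.symm.injOn (hmem z hz).1 (hmem w hw).1 h1
  rw [him, lintegral_image_eq_lintegral_abs_det_fderiv_mul volume (measurableSet_image φ hA hAφ)
    (f' := τ) (fun z hz => (hτ' ⟨z, hz⟩).differentiableAt.hasFDerivAt.hasFDerivWithinAt) hinj]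
  refine setLIntegral_congr_fun (measurableSet_image φ hA hAφ) fun z hz => ?_
  change chartDensity g φ z = ENNReal.ofReal |(fderiv ℝ (ψ ∘ φ.symm) z).det| * _
  rw [hρ ⟨z, hz⟩, (hτ' ⟨z, hz⟩).fderiv]
  rfl

variable [SecondCountableTopology M]

/-- On the domain of a chart `φ` the Riemannian volume, a supremum over the whole atlas, is the
volume of `φ`. The upper bound comes from a measure glued from countably many charts, which
dominates the volume of each chart and agrees with it on the chart domain. -/
theorem riemannianVolume_apply (g : Metric n M) {φ : OpenPartialHomeomorph M (Model n)}
    (hφ : φ ∈ atlas (Model n) M) {A : Set M} (hA : MeasurableSet A) (hAφ : A ⊆ φ.source) :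
    riemannianVolume g A = chartVolume g φ A := by
  refine le_antisymm ?_ (Measure.le_iff'.1 (le_iSup₂
    (f := fun φ (_ : φ ∈ atlas (Model n) M) => chartVolume g φ) φ hφ) A)
  rcases isEmpty_or_nonempty M with _ | ⟨⟨x₀⟩⟩
  · rw [A.eq_empty_of_isEmpty]; simp
  obtain ⟨s, hs, hsU⟩ : ∃ s : Set M, s.Countable ∧ ⋃ x ∈ s, (chartAt (Model n) x).source = univ :=
    TopologicalSpace.countable_cover_nhds fun x : M => chart_source_mem_nhds (Model n) x
  have hsne : s.Nonempty := by
    by_contra h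
    rw [not_nonempty_iff_eq_empty.1 h] at hsU
    simp only [mem_empty_iff_false, iUnion_of_empty, iUnion_empty] at hsU
    exact (hsU ▸ mem_univ x₀ : x₀ ∈ (∅ : Set M))
  obtain ⟨p, rfl⟩ := hs.exists_eq_range hsne
  let e : ℕ → OpenPartialHomeomorph M (Model n) := fun k => chartAt (Model n) (p k)
  have he : ∀ k, e k ∈ atlas (Model n) M := fun k => chart_mem_atlas _ _
  let B : ℕ → Set M := disjointed fun k => (e k).source
  have hBm : ∀ k, MeasurableSet (B k) :=
    fun k => MeasurableSet.disjointed (fun k => (e k).open_source.measurableSet) k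
  have hBe : ∀ k, B k ⊆ (e k).source := fun k => disjointed_subset _ k
  have hBU : ⋃ k, B k = univ := by
    rw [iUnion_disjointed, ← hsU, biUnion_range]
  have hBd : Pairwise (Function.onFun Disjoint B) := disjoint_disjointed _
  let m₀ : Measure M := Measure.sum fun k => (chartVolume g (e k)).restrict (B k)
  have hm₀ : ∀ ψ ∈ atlas (Model n) M, ∀ A : Set M, MeasurableSet A →
      chartVolume g ψ A = m₀ (A ∩ ψ.source) := by
    intro ψ hψ A hA
    have hAm := hA.inter ψ.open_source.measurableSet
    have h1 : chartVolume g ψ A = chartVolume g ψ (A ∩ ψ.source) := by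
      rw [chartVolume_apply g ψ hA, chartVolume_apply g ψ hAm, inter_comm A, ← inter_assoc,
        inter_self]
    rw [h1, Measure.sum_apply _ hAm]
    conv_lhs => rw [← inter_univ (A ∩ ψ.source), ← hBU, inter_iUnion]
    rw [measure_iUnion (fun i j hij => (hBd hij).mono inter_subset_right inter_subset_right)
      (fun k => hAm.inter (hBm k))]
    refine tsum_congr fun k => ?_
    rw [Measure.restrict_apply hAm]
    exact chartVolume_eq g hψ (he k) (hAm.inter (hBm k))
      (inter_subset_left.trans inter_subset_right) (inter_subset_right.trans (hBe k))
  have hle : riemannianVolume g ≤ m₀ := by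
    refine iSup₂_le fun ψ hψ => Measure.le_iff.2 fun A hA => ?_
    rw [hm₀ ψ hψ A hA]
    exact measure_mono inter_subset_left
  rw [hm₀ φ hφ A hA, inter_eq_self_of_subset_left hAφ]
  exact Measure.le_iff'.1 hle A

theorem riemannianVolume_restrict_source (g : Metric n M) {φ : OpenPartialHomeomorph M (Model n)}
    (hφ : φ ∈ atlas (Model n) M) :
    (riemannianVolume g).restrict φ.source =
      ((volume.restrict φ.target).withDensity (chartDensity g φ)).map φ.symm := by
  ext A hA
  rw [Measure.restrict_apply hA, riemannianVolume_apply g hφ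
    (hA.inter φ.open_source.measurableSet) inter_subset_right, chartVolume_apply g φ
    (hA.inter φ.open_source.measurableSet), inter_comm A, ← inter_assoc, inter_self,
    ← chartVolume_apply g φ hA]
  rfl

theorem riemannianVolume_symm_image (g : Metric n M) {φ : OpenPartialHomeomorph M (Model n)}
    (hφ : φ ∈ atlas (Model n) M) {B : Set (Model n)} (hB : MeasurableSet B) (hBφ : B ⊆ φ.target) :
    riemannianVolume g (φ.symm '' B) = ∫⁻ z in B, chartDensity g φ z := by
  have h1 : φ.symm '' B ⊆ φ.source := by
    rintro _ ⟨z, hz, rfl⟩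
    exact φ.map_target (hBφ hz)
  have h2 : φ '' (φ.symm '' B) = B := φ.symm.symm_image_image_of_subset_source hBφ
  have h3 := measurableSet_symm_image φ hB hBφ
  rw [riemannianVolume_apply g hφ h3 h1, chartVolume_apply g φ h3,
    inter_eq_self_of_subset_right h1, h2]

theorem riemannianVolume_eq_zero_of_image (g : Metric n M)
    {φ : OpenPartialHomeomorph M (Model n)} (hφ : φ ∈ atlas (Model n) M) {A : Set M}
    (hAφ : A ⊆ φ.source) (hA : volume (φ '' A) = 0) : riemannianVolume g A = 0 := by
  obtain ⟨Z, hAZ, hZ, hZ0⟩ := exists_measurable_superset_of_null hA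
  have h1 : A ⊆ φ.symm '' (Z ∩ φ.target) := fun x hx =>
    ⟨φ x, ⟨hAZ (mem_image_of_mem _ hx), φ.map_source (hAφ hx)⟩, φ.left_inv (hAφ hx)⟩
  refine measure_mono_null h1 ?_
  rw [riemannianVolume_symm_image g hφ (hZ.inter φ.open_target.measurableSet) inter_subset_right]
  exact setLIntegral_measure_zero _ _ (measure_mono_null inter_subset_left hZ0)

theorem aemeasurable_comp_symm (g : Metric n M) {φ : OpenPartialHomeomorph M (Model n)}
    (hφ : φ ∈ atlas (Model n) M) {f : M → ℝ≥0∞} (hf : AEMeasurable f (riemannianVolume g)) :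
    AEMeasurable (fun z => f (φ.symm z)) (volume.restrict φ.target) := by
  have h1 : AEMeasurable f (((volume.restrict φ.target).withDensity (chartDensity g φ)).map
      φ.symm) := by
    rw [← riemannianVolume_restrict_source g hφ]
    exact hf.restrict
  refine (h1.comp_aemeasurable (aemeasurable_symm g φ)).mono_ac ?_
  refine withDensity_absolutelyContinuous' (aemeasurable_chartDensity g hφ) ?_
  exact (ae_restrict_iff' φ.open_target.measurableSet).2
    (Eventually.of_forall fun z hz => chartDensity_ne_zero g hφ hz)

/-- A measure with density `f` with respect to the Riemannian volume has, in the chart `φ`, the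
density `√(det g_ij) * f` with respect to Lebesgue measure. -/
theorem withDensity_symm_image (g : Metric n M) {φ : OpenPartialHomeomorph M (Model n)}
    (hφ : φ ∈ atlas (Model n) M) {f : M → ℝ≥0∞} (hf : AEMeasurable f (riemannianVolume g))
    {B : Set (Model n)} (hB : MeasurableSet B) (hBφ : B ⊆ φ.target) :
    (riemannianVolume g).withDensity f (φ.symm '' B) =
      ∫⁻ z in B, chartDensity g φ z * f (φ.symm z) := by
  have h1 : φ.symm '' B ⊆ φ.source := by
    rintro _ ⟨z, hz, rfl⟩
    exact φ.map_target (hBφ hz)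
  have h3 := measurableSet_symm_image φ hB hBφ
  have hfi : AEMeasurable ((φ.symm '' B).indicator f)
      (((volume.restrict φ.target).withDensity (chartDensity g φ)).map φ.symm) := by
    rw [← riemannianVolume_restrict_source g hφ]
    exact (hf.indicator h3).restrict
  have hfi' : AEMeasurable (fun z => (φ.symm '' B).indicator f (φ.symm z))
      (volume.restrict φ.target) := aemeasurable_comp_symm g hφ (hf.indicator h3)
  have h4 : ∫⁻ x in φ.symm '' B, f x ∂(riemannianVolume g) =
      ∫⁻ x in φ.source, (φ.symm '' B).indicator f x ∂(riemannianVolume g) := by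
    rw [setLIntegral_indicator h3, inter_eq_self_of_subset_left h1]
  rw [withDensity_apply _ h3, h4, riemannianVolume_restrict_source g hφ,
    lintegral_map' hfi (aemeasurable_symm g φ),
    lintegral_withDensity_eq_lintegral_mul₀ (aemeasurable_chartDensity g hφ) hfi']
  have h5 : ∫⁻ z in B, chartDensity g φ z * f (φ.symm z) =
      ∫⁻ z in φ.target, B.indicator (fun z => chartDensity g φ z * f (φ.symm z)) z := by
    rw [setLIntegral_indicator hB, inter_eq_self_of_subset_left hBφ]
  rw [h5]
  refine setLIntegral_congr_fun φ.open_target.measurableSet fun z hz => ?_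
  have hiff : φ.symm z ∈ φ.symm '' B ↔ z ∈ B :=
    ⟨fun ⟨w, hw, hwz⟩ => φ.symm.injOn (hBφ hw) hz hwz ▸ hw, mem_image_of_mem _⟩
  by_cases hzB : z ∈ B
  · simp [hzB, indicator_of_mem (hiff.2 hzB)]
  · simp [hzB, indicator_of_notMem (mt hiff.1 hzB)]

end Volume

/-! ### Optimal couplings -/

section Kantorovich

theorem integrable_and_abs_integral_sub_le {Z : Type*} [MeasurableSpace Z] {ρ : Measure Z}
    [IsFiniteMeasure ρ] {f : Z → ℝ} (hf : AEStronglyMeasurable f ρ) {a ε : ℝ}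
    (h : ∀ᵐ z ∂ρ, |f z - a| ≤ ε) :
    Integrable f ρ ∧ |∫ z, f z ∂ρ - ρ.real univ * a| ≤ ε * ρ.real univ := by
  have hi : Integrable f ρ := by
    refine Integrable.of_bound hf (|a| + ε) ?_
    filter_upwards [h] with z hz
    rw [Real.norm_eq_abs]
    have h1 := abs_add_le (f z - a) a
    rw [sub_add_cancel] at h1
    linarith
  refine ⟨hi, ?_⟩
  have h1 : ∫ z, f z ∂ρ - ρ.real univ * a = ∫ z, (f z - a) ∂ρ := by
    rw [integral_sub hi (integrable_const a), integral_const, smul_eq_mul]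
  rw [h1, ← Real.norm_eq_abs]
  exact norm_integral_le_of_norm_le_const (f := fun z => f z - a) h

variable {X Y : Type*} [MeasurableSpace X] [MeasurableSpace Y]

theorem IsCoupling.isProbabilityMeasure {μ : Measure X} {ν : Measure Y} [IsProbabilityMeasure μ]
    {γ : Measure (X × Y)} (h : IsCoupling μ ν γ) : IsProbabilityMeasure γ := by
  refine ⟨?_⟩
  rw [← preimage_univ (f := Prod.fst), ← Measure.map_apply measurable_fst MeasurableSet.univ,
    h.map_fst]
  exact measure_univ

/-- A coupling concentrated on the graph of an injective map transports `μ` to `ν` along the map. -/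
theorem IsCoupling.measure_image_eq {μ : Measure X} {ν : Measure Y} {γ : Measure (X × Y)}
    (h : IsCoupling μ ν γ) {D : Set X} {T : X → Y} (hT : InjOn T D)
    (hgraph : ∀ᵐ p ∂γ, p.1 ∈ D ∧ p.2 = T p.1) {A : Set X} (hAD : A ⊆ D) (hA : MeasurableSet A)
    (hTA : MeasurableSet (T '' A)) : μ A = ν (T '' A) := by
  rw [← h.map_fst, ← h.map_snd, Measure.map_apply measurable_fst hA,
    Measure.map_apply measurable_snd hTA]
  refine measure_congr ?_
  filter_upwards [hgraph] with p hp
  refine propext ⟨fun h1 => ⟨p.1, h1, hp.2.symm⟩, fun ⟨x, hx, hxp⟩ => ?_⟩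
  have h1 : x = p.1 := hT (hAD hx) hp.1 (hxp.trans hp.2)
  change p.1 ∈ A
  rwa [← h1]

variable [TopologicalSpace X] [TopologicalSpace Y]

theorem IsCoupling.mem_support_of_graph [OpensMeasurableSpace X] [OpensMeasurableSpace Y]
    {μ : Measure X} {ν : Measure Y} {γ : Measure (X × Y)}
    (h : IsCoupling μ ν γ) {D : Set X} {T : X → Y} (hT : ContinuousOn T D)
    (hgraph : ∀ᵐ p ∂γ, p.1 ∈ D ∧ p.2 = T p.1) {x : X} (hxD : x ∈ D) (hx : x ∈ μ.support) :
    (x, T x) ∈ γ.support := by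
  rw [Measure.mem_support_iff_forall]
  intro W hW
  obtain ⟨U, hU, V, hV, hUV⟩ := mem_nhds_prod_iff.1 hW
  obtain ⟨O, hO, hxO, hOV⟩ := mem_nhdsWithin.1 (hT x hxD hV)
  have hpos : 0 < μ (O ∩ interior U) := (Measure.mem_support_iff_forall x).1 hx _
    (inter_mem (hO.mem_nhds hxO) (interior_mem_nhds.2 hU))
  rw [← h.map_fst, Measure.map_apply measurable_fst
    (hO.inter isOpen_interior).measurableSet] at hpos
  refine hpos.trans_le (measure_mono_ae ?_)
  filter_upwards [hgraph] with p hp hpO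
  refine hUV ⟨interior_subset hpO.2, ?_⟩
  rw [hp.2]
  exact hOV ⟨hpO.1, hp.1⟩

/-- The support of an optimal coupling is monotone with respect to the cost: otherwise the total
cost would decrease if some of the mass near `(x, y)` and `(x', y')` were moved to `(x, y')` and
`(x', y)`. To keep the marginals, the restrictions of `γ` to small rectangles around `(x, y)` and
`(x', y')` are replaced by the products of their exchanged marginals. -/
theorem IsOptimal.two_monotone [SecondCountableTopology X] [SecondCountableTopology Y]
    [BorelSpace X] [BorelSpace Y] {μ : Measure X} {ν : Measure Y} [IsProbabilityMeasure μ]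
    {c : X × Y → ℝ} (hc : Continuous c) {γ : Measure (X × Y)} (h : IsOptimal c μ ν γ)
    {x x' : X} {y y' : Y} (hp : (x, y) ∈ γ.support) (hp' : (x', y') ∈ γ.support) :
    c (x, y) + c (x', y') ≤ c (x, y') + c (x', y) := by
  have := h.coupling.isProbabilityMeasure
  by_contra! hlt
  set ε : ℝ := (c (x, y) + c (x', y') - (c (x, y') + c (x', y))) / 8 with hε
  have hε0 : 0 < ε := by rw [hε]; linarith
  have hnear : ∀ (u : X) (v : Y), ∃ U V, IsOpen U ∧ u ∈ U ∧ IsOpen V ∧ v ∈ V ∧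
      ∀ p ∈ U ×ˢ V, |c p - c (u, v)| ≤ ε := by
    intro u v
    have h1 : {p | |c p - c (u, v)| < ε} ∈ 𝓝 (u, v) :=
      (Metric.continuous_iff'.1 hc (u, v) ε hε0)
    obtain ⟨U, V, hU, hu, hV, hv, hUV⟩ := mem_nhds_prod_iff'.1 h1
    exact ⟨U, V, hU, hu, hV, hv, fun p hp => (hUV hp).le⟩
  obtain ⟨U₁, V₁, hU₁, hxU₁, hV₁, hyV₁, h₁⟩ := hnear x y
  obtain ⟨U₂, V₂, hU₂, hxU₂, hV₂, hyV₂, h₂⟩ := hnear x' y'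
  obtain ⟨U₃, V₃, hU₃, hxU₃, hV₃, hyV₃, h₃⟩ := hnear x y'
  obtain ⟨U₄, V₄, hU₄, hxU₄, hV₄, hyV₄, h₄⟩ := hnear x' y
  set U := U₁ ∩ U₃
  set V := V₁ ∩ V₄
  set U' := U₂ ∩ U₄
  set V' := V₂ ∩ V₃
  have hU : IsOpen U := hU₁.inter hU₃
  have hV : IsOpen V := hV₁.inter hV₄
  have hU' : IsOpen U' := hU₂.inter hU₄
  have hV' : IsOpen V' := hV₂.inter hV₃
  have hR : MeasurableSet (U ×ˢ V) := hU.measurableSet.prod hV.measurableSet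
  have hR' : MeasurableSet (U' ×ˢ V') := hU'.measurableSet.prod hV'.measurableSet
  set m₁ := γ (U ×ˢ V)
  set m₂ := γ (U' ×ˢ V')
  have hm₁0 : 0 < m₁ := (Measure.mem_support_iff_forall _).1 hp _
    ((hU.prod hV).mem_nhds ⟨⟨hxU₁, hxU₃⟩, hyV₁, hyV₄⟩)
  have hm₂0 : 0 < m₂ := (Measure.mem_support_iff_forall _).1 hp' _
    ((hU'.prod hV').mem_nhds ⟨⟨hxU₂, hxU₄⟩, hyV₂, hyV₃⟩)
  have hm₁t : m₁ ≠ ⊤ := measure_ne_top _ _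
  have hm₂t : m₂ ≠ ⊤ := measure_ne_top _ _
  set α₁ := γ.restrict (U ×ˢ V)
  set α₂ := γ.restrict (U' ×ˢ V')
  have hα₁u : α₁ univ = m₁ := Measure.restrict_apply_univ _
  have hα₂u : α₂ univ = m₂ := Measure.restrict_apply_univ _
  have hae₁ : ∀ᵐ p ∂α₁, p ∈ U ×ˢ V := ae_restrict_mem hR
  have hae₂ : ∀ᵐ p ∂α₂, p ∈ U' ×ˢ V' := ae_restrict_mem hR'
  have half : (2⁻¹ : ℝ≥0∞) ≠ ⊤ := by simp
  set s₁ : ℝ≥0 := (2⁻¹ * m₂).toNNReal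
  set s₂ : ℝ≥0 := (2⁻¹ * m₁).toNNReal
  have hs₁ : (s₁ : ℝ≥0∞) = 2⁻¹ * m₂ := ENNReal.coe_toNNReal (ENNReal.mul_ne_top half hm₂t)
  have hs₂ : (s₂ : ℝ≥0∞) = 2⁻¹ * m₁ := ENNReal.coe_toNNReal (ENNReal.mul_ne_top half hm₁t)
  -- `ρ₁ + ρ₂` is removed from `γ` and replaced by `ρ₃ + ρ₄`. All four have mass `m₁ * m₂ / 2`, and
  -- the factor `1 / 2` ensures that `ρ₁ + ρ₂ ≤ γ`.
  set ρ₁ : Measure (X × Y) := s₁ • α₁ with hρ₁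
  set ρ₂ : Measure (X × Y) := s₂ • α₂ with hρ₂
  set ρ₃ : Measure (X × Y) := (2⁻¹ : ℝ≥0) • (α₁.map Prod.fst).prod (α₂.map Prod.snd) with hρ₃
  set ρ₄ : Measure (X × Y) := (2⁻¹ : ℝ≥0) • (α₂.map Prod.fst).prod (α₁.map Prod.snd) with hρ₄
  have hu : ∀ α : Measure (X × Y), α.map Prod.fst univ = α univ ∧ α.map Prod.snd univ = α univ :=
    fun α => ⟨by rw [Measure.map_apply measurable_fst .univ, preimage_univ],
      by rw [Measure.map_apply measurable_snd .univ, preimage_univ]⟩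
  have hm₁1 : m₁ ≤ 1 := prob_le_one
  have hm₂1 : m₂ ≤ 1 := prob_le_one
  have hle : ρ₁ + ρ₂ ≤ γ := by
    refine Measure.le_iff.2 fun A _ => ?_
    have e₁ : ρ₁ A ≤ 2⁻¹ * γ A := by
      rw [hρ₁, Measure.smul_apply, ENNReal.smul_def, smul_eq_mul, hs₁]
      refine mul_le_mul' ?_ (Measure.restrict_apply_le _ _)
      simpa using mul_le_mul' (le_refl (2⁻¹ : ℝ≥0∞)) hm₂1
    have e₂ : ρ₂ A ≤ 2⁻¹ * γ A := by
      rw [hρ₂, Measure.smul_apply, ENNReal.smul_def, smul_eq_mul, hs₂]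
      refine mul_le_mul' ?_ (Measure.restrict_apply_le _ _)
      simpa using mul_le_mul' (le_refl (2⁻¹ : ℝ≥0∞)) hm₁1
    calc (ρ₁ + ρ₂) A = ρ₁ A + ρ₂ A := rfl
      _ ≤ 2⁻¹ * γ A + 2⁻¹ * γ A := add_le_add e₁ e₂
      _ = γ A := by rw [← add_mul, ENNReal.inv_two_add_inv_two, one_mul]
  set δ : Measure (X × Y) := γ - (ρ₁ + ρ₂) with hδ
  have hδγ : δ + (ρ₁ + ρ₂) = γ := Measure.sub_add_cancel_of_le hle
  have hfst : (ρ₁ + ρ₂).map Prod.fst = (ρ₃ + ρ₄).map Prod.fst := by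
    simp only [Measure.map_add _ _ measurable_fst, hρ₁, hρ₂, hρ₃, hρ₄, Measure.map_smul,
      Measure.map_fst_prod, (hu _).2, hα₁u, hα₂u]
    ext A _
    simp only [Measure.add_apply, Measure.smul_apply, ENNReal.smul_def, smul_eq_mul, hs₁, hs₂,
      mul_assoc]
    simp
  have hsnd : (ρ₁ + ρ₂).map Prod.snd = (ρ₃ + ρ₄).map Prod.snd := by
    simp only [Measure.map_add _ _ measurable_snd, hρ₁, hρ₂, hρ₃, hρ₄, Measure.map_smul,
      Measure.map_snd_prod, (hu _).1, hα₁u, hα₂u]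
    ext A _
    simp only [Measure.add_apply, Measure.smul_apply, ENNReal.smul_def, smul_eq_mul, hs₁, hs₂,
      mul_assoc]
    simp [add_comm]
  have hcoup : IsCoupling μ ν (δ + (ρ₃ + ρ₄)) := by
    constructor
    · rw [Measure.map_add _ _ measurable_fst, ← hfst, ← Measure.map_add _ _ measurable_fst, hδγ,
        h.coupling.map_fst]
    · rw [Measure.map_add _ _ measurable_snd, ← hsnd, ← Measure.map_add _ _ measurable_snd, hδγ,
        h.coupling.map_snd]
  have hκ : ∀ ρ : Measure (X × Y), ρ univ = 2⁻¹ * (m₁ * m₂) →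
      ρ.real univ = (2⁻¹ * (m₁ * m₂)).toReal := fun ρ hρ => by rw [Measure.real, hρ]
  set κ : ℝ := (2⁻¹ * (m₁ * m₂)).toReal
  have hκ0 : 0 < κ := ENNReal.toReal_pos
    (mul_ne_zero (by simp) (mul_ne_zero hm₁0.ne' hm₂0.ne'))
    (ENNReal.mul_ne_top half (ENNReal.mul_ne_top hm₁t hm₂t))
  have k₁ : ρ₁.real univ = κ := hκ _ (by
    rw [hρ₁, Measure.smul_apply, ENNReal.smul_def, smul_eq_mul, hs₁, hα₁u]; ring)
  have k₂ : ρ₂.real univ = κ := hκ _ (by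
    rw [hρ₂, Measure.smul_apply, ENNReal.smul_def, smul_eq_mul, hs₂, hα₂u]; ring)
  have k₃ : ρ₃.real univ = κ := hκ _ (by
    rw [hρ₃, Measure.smul_apply, ENNReal.smul_def, smul_eq_mul, ← univ_prod_univ,
      Measure.prod_prod, (hu _).1, (hu _).2, hα₁u, hα₂u]; simp)
  have k₄ : ρ₄.real univ = κ := hκ _ (by
    rw [hρ₄, Measure.smul_apply, ENNReal.smul_def, smul_eq_mul, ← univ_prod_univ,
      Measure.prod_prod, (hu _).1, (hu _).2, hα₁u, hα₂u, mul_comm m₂]; simp)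
  have hcm : ∀ ρ : Measure (X × Y), AEStronglyMeasurable c ρ := fun ρ => hc.aestronglyMeasurable
  have hprod : ∀ (α α' : Measure (X × Y)) [IsFiniteMeasure α] [IsFiniteMeasure α'] (O : Set X)
      (O' : Set Y), MeasurableSet O → MeasurableSet O' → (∀ᵐ p ∂α, p.1 ∈ O) →
      (∀ᵐ p ∂α', p.2 ∈ O') → ∀ᵐ p ∂((α.map Prod.fst).prod (α'.map Prod.snd)), p ∈ O ×ˢ O' := by
    intro α α' _ _ O O' hO hO' ha ha'
    have b1 : ∀ᵐ q ∂(α.map Prod.fst), q ∈ O :=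
      (ae_map_iff measurable_fst.aemeasurable hO).2 ha
    have b2 : ∀ᵐ q ∂(α'.map Prod.snd), q ∈ O' :=
      (ae_map_iff measurable_snd.aemeasurable hO').2 ha'
    have b3 := Measure.quasiMeasurePreserving_fst (μ := α.map Prod.fst)
      (ν := α'.map Prod.snd) |>.ae b1
    have b4 := Measure.quasiMeasurePreserving_snd (μ := α.map Prod.fst)
      (ν := α'.map Prod.snd) |>.ae b2
    filter_upwards [b3, b4] with p c3 c4 using ⟨c3, c4⟩
  obtain ⟨i₁, j₁⟩ := integrable_and_abs_integral_sub_le (hcm ρ₁) (a := c (x, y)) (ε := ε) (by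
    refine (Measure.smul_absolutelyContinuous (c := s₁)).ae_le ?_
    filter_upwards [hae₁] with p hp using h₁ p ⟨hp.1.1, hp.2.1⟩)
  obtain ⟨i₂, j₂⟩ := integrable_and_abs_integral_sub_le (hcm ρ₂) (a := c (x', y')) (ε := ε) (by
    refine (Measure.smul_absolutelyContinuous (c := s₂)).ae_le ?_
    filter_upwards [hae₂] with p hp using h₂ p ⟨hp.1.1, hp.2.1⟩)
  obtain ⟨i₃, j₃⟩ := integrable_and_abs_integral_sub_le (hcm ρ₃) (a := c (x, y')) (ε := ε) (by
    refine (Measure.smul_absolutelyContinuous (c := (2⁻¹ : ℝ≥0))).ae_le ?_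
    filter_upwards [hprod α₁ α₂ U V' hU.measurableSet hV'.measurableSet
      (hae₁.mono fun p hp => hp.1) (hae₂.mono fun p hp => hp.2)]
      with p hp using h₃ p ⟨hp.1.2, hp.2.2⟩)
  obtain ⟨i₄, j₄⟩ := integrable_and_abs_integral_sub_le (hcm ρ₄) (a := c (x', y)) (ε := ε) (by
    refine (Measure.smul_absolutelyContinuous (c := (2⁻¹ : ℝ≥0))).ae_le ?_
    filter_upwards [hprod α₂ α₁ U' V hU'.measurableSet hV.measurableSet
      (hae₂.mono fun p hp => hp.1) (hae₁.mono fun p hp => hp.2)]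
      with p hp using h₄ p ⟨hp.1.2, hp.2.2⟩)
  have iδ : Integrable c δ := h.integrable.mono_measure Measure.sub_le
  have hmin := h.minimal (δ + (ρ₃ + ρ₄)) hcoup (iδ.add_measure (i₃.add_measure i₄))
  rw [integral_add_measure iδ (i₃.add_measure i₄), integral_add_measure i₃ i₄, ← hδγ,
    integral_add_measure iδ (i₁.add_measure i₂), integral_add_measure i₁ i₂] at hmin
  rw [k₁, abs_le] at j₁
  rw [k₂, abs_le] at j₂
  rw [k₃, abs_le] at j₃
  rw [k₄, abs_le] at j₄
  have h5 : κ * (c (x, y) + c (x', y') - (c (x, y') + c (x', y)) - 4 * ε) ≤ 0 := by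
    linarith [j₁.1, j₂.1, j₃.2, j₄.2]
  have h6 : 0 < c (x, y) + c (x', y') - (c (x, y') + c (x', y)) - 4 * ε := by
    rw [hε]; linarith
  exact absurd h5 (not_le.2 (mul_pos hκ0 h6))

end Kantorovich

/-! ### Differentiability of maps with monotone graph -/

section Coordinates

variable {n : ℕ} {M N : Type*} [TopologicalSpace M] [ChartedSpace (Model n) M]
  [IsManifold (𝓡 n) ∞ M] [TopologicalSpace N] [ChartedSpace (Model n) N] [IsManifold (𝓡 n) ∞ N]

theorem mdifferentiableWithinAt_of_chart {φ : OpenPartialHomeomorph M (Model n)}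
    (hφ : φ ∈ atlas (Model n) M) {ψ : OpenPartialHomeomorph N (Model n)}
    (hψ : ψ ∈ atlas (Model n) N) {T : M → N} {W : Set M} (hWφ : W ⊆ φ.source)
    (hWψ : MapsTo T W ψ.source) {x : M} (hx : x ∈ W)
    (h : DifferentiableWithinAt ℝ (ψ ∘ T ∘ φ.symm) (φ '' W) (φ x)) :
    MDifferentiableWithinAt (𝓡 n) (𝓡 n) T W x := by
  have h1 : MDifferentiableWithinAt (𝓡 n) (𝓡 n) φ W x :=
    (mdifferentiableAt_atlas hφ (hWφ hx)).mdifferentiableWithinAt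
  have h2 : MDifferentiableWithinAt (𝓡 n) (𝓡 n) (ψ ∘ T ∘ φ.symm) (φ '' W) (φ x) :=
    h.mdifferentiableWithinAt
  have hx' : (ψ ∘ T ∘ φ.symm) (φ x) = ψ (T x) := by
    simp [φ.left_inv (hWφ hx)]
  have h3 : MDifferentiableAt (𝓡 n) (𝓡 n) ψ.symm ((ψ ∘ T ∘ φ.symm) (φ x)) := by
    rw [hx']
    exact mdifferentiableAt_atlas_symm hψ (ψ.map_source (hWψ hx))
  have h4 := (h3.comp_mdifferentiableWithinAt (φ x) h2).comp x h1 (subset_preimage_image φ W)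
  refine h4.congr (fun y hy => ?_) ?_
  · simp [φ.left_inv (hWφ hy), ψ.left_inv (hWψ hy)]
  · simp [φ.left_inv (hWφ hx), ψ.left_inv (hWψ hx)]

theorem hasFDerivWithinAt_chart {φ : OpenPartialHomeomorph M (Model n)}
    (hφ : φ ∈ atlas (Model n) M) {ψ : OpenPartialHomeomorph N (Model n)}
    (hψ : ψ ∈ atlas (Model n) N) {T : M → N} {W : Set M} {Q : Set (Model n)}
    (hQ : MapsTo φ.symm Q W) {z : Model n} (hz : z ∈ φ.target) (hTz : T (φ.symm z) ∈ ψ.source)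
    {T' : TangentSpace (𝓡 n) (φ.symm z) →L[ℝ] TangentSpace (𝓡 n) (T (φ.symm z))}
    (h : HasMFDerivWithinAt (𝓡 n) (𝓡 n) T W (φ.symm z) T') :
    HasFDerivWithinAt (ψ ∘ T ∘ φ.symm)
      (((mfderiv (𝓡 n) (𝓡 n) ψ (T (φ.symm z))).comp
        (T'.comp (mfderiv (𝓡 n) (𝓡 n) φ.symm z)) : Model n →L[ℝ] Model n)) Q z := by
  have h1 : HasMFDerivWithinAt (𝓡 n) (𝓡 n) φ.symm Q z (mfderiv (𝓡 n) (𝓡 n) φ.symm z) :=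
    (mdifferentiableAt_atlas_symm hφ hz).hasMFDerivAt.hasMFDerivWithinAt
  have h2 : HasMFDerivAt (𝓡 n) (𝓡 n) ψ (T (φ.symm z)) (mfderiv (𝓡 n) (𝓡 n) ψ (T (φ.symm z))) :=
    (mdifferentiableAt_atlas hψ hTz).hasMFDerivAt
  exact hasMFDerivWithinAt_iff_hasFDerivWithinAt.1
    (h2.comp_hasMFDerivWithinAt z (h.comp z h1 hQ))

theorem contDiffAt_chart {c : M × N → ℝ} (hc : ContMDiff ((𝓡 n).prod (𝓡 n)) 𝓘(ℝ, ℝ) 2 c)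
    {φ : OpenPartialHomeomorph M (Model n)} (hφ : φ ∈ atlas (Model n) M)
    {ψ : OpenPartialHomeomorph N (Model n)} (hψ : ψ ∈ atlas (Model n) N) {u v : Model n}
    (hu : u ∈ φ.target) (hv : v ∈ ψ.target) :
    ContDiffAt ℝ 2 (fun p : Model n × Model n => c (φ.symm p.1, ψ.symm p.2)) (u, v) := by
  have hle : (2 : WithTop ℕ∞) ≤ ((⊤ : ℕ∞) : WithTop ℕ∞) := by
    exact WithTop.coe_le_coe.2 (le_top : (2 : ℕ∞) ≤ ⊤)
  have h1 : ContMDiffAt (𝓡 n) (𝓡 n) 2 φ.symm u :=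
    ((contMDiffOn_symm_of_mem_maximalAtlas (IsManifold.subset_maximalAtlas hφ)).contMDiffAt
      (φ.open_target.mem_nhds hu)).of_le hle
  have h2 : ContMDiffAt (𝓡 n) (𝓡 n) 2 ψ.symm v :=
    ((contMDiffOn_symm_of_mem_maximalAtlas (IsManifold.subset_maximalAtlas hψ)).contMDiffAt
      (ψ.open_target.mem_nhds hv)).of_le hle
  have h3 : ContMDiffAt 𝓘(ℝ, Model n × Model n) (𝓡 n) 2
      (fun p : Model n × Model n => φ.symm p.1) (u, v) :=
    ContMDiffAt.comp (u, v) h1 contDiffAt_fst.contMDiffAt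
  have h4 : ContMDiffAt 𝓘(ℝ, Model n × Model n) (𝓡 n) 2
      (fun p : Model n × Model n => ψ.symm p.2) (u, v) :=
    ContMDiffAt.comp (u, v) h2 contDiffAt_snd.contMDiffAt
  exact contMDiffAt_iff_contDiffAt.1 (hc.contMDiffAt.comp (u, v) (h3.prodMk h4))

end Coordinates

section Monotone

variable {n : ℕ}

/-- Near a point where the matrix of mixed second derivatives of `c` is invertible, `u` is a
Lipschitz function of `u + A v` on every set that is monotone with respect to `c`. The map `A` is
chosen so that the mixed second derivative is `(v, u) ↦ -⟪A v, u⟫`; monotonicity then reads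
`⟪u' - u, A (v' - v)⟫ ≥ -½ ‖u' - u‖ ‖A (v' - v)‖` on a small ball. -/
theorem exists_dist_le_of_nondegenerate {c : Model n × Model n → ℝ} {u₀ v₀ : Model n}
    (hc : ContDiffAt ℝ 2 c (u₀, v₀))
    (hdet : (Matrix.of fun i j => fderiv ℝ (fun v : Model n =>
        fderiv ℝ (fun u : Model n => c (u, v)) u₀ (EuclideanSpace.single i 1))
      v₀ (EuclideanSpace.single j (1 : ℝ))).det ≠ 0) :
    ∃ A : Model n ≃L[ℝ] Model n, ∃ r > 0, ∀ u ∈ Metric.ball u₀ r, ∀ u' ∈ Metric.ball u₀ r,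
      ∀ v ∈ Metric.ball v₀ r, ∀ v' ∈ Metric.ball v₀ r,
      c (u, v) + c (u', v') ≤ c (u, v') + c (u', v) →
      dist u u' ≤ 2 * dist (u + A v) (u' + A v') := by
  set D₁ : Model n × Model n → (Model n →L[ℝ] ℝ) := fun p =>
    (fderiv ℝ c p).comp (ContinuousLinearMap.inl ℝ (Model n) (Model n))
  have hdiff : ∀ᶠ p in 𝓝 (u₀, v₀), DifferentiableAt ℝ c p :=
    (hc.eventually (by simp)).mono fun p hp => hp.differentiableAt (by simp)
  have hpartial : ∀ p, DifferentiableAt ℝ c p →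
      HasFDerivAt (fun u => c (u, p.2)) (D₁ p) p.1 := by
    intro p hp
    exact hp.hasFDerivAt.comp p.1 (hasFDerivAt_prodMk_left p.1 p.2)
  have hD₁c : ContDiffAt ℝ 1 D₁ (u₀, v₀) :=
    (hc.fderiv_right (m := 1) (by norm_num)).clm_comp contDiffAt_const
  have hstrict := hD₁c.hasStrictFDerivAt (by simp)
  set L := fderiv ℝ D₁ (u₀, v₀)
  set b : Model n →L[ℝ] (Model n →L[ℝ] ℝ) :=
    L.comp (ContinuousLinearMap.inr ℝ (Model n) (Model n)) with hb
  have hentry : ∀ i j, fderiv ℝ (fun v : Model n =>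
        fderiv ℝ (fun u : Model n => c (u, v)) u₀ (EuclideanSpace.single i 1))
      v₀ (EuclideanSpace.single j (1 : ℝ)) =
      b (EuclideanSpace.single j 1) (EuclideanSpace.single i 1) := by
    intro i j
    have e1 : HasFDerivAt (fun v => D₁ (u₀, v)) b v₀ :=
      hstrict.hasFDerivAt.comp v₀ (hasFDerivAt_prodMk_right u₀ v₀)
    have e2 : HasFDerivAt (fun v => D₁ (u₀, v) (EuclideanSpace.single i 1))
        ((ContinuousLinearMap.apply ℝ ℝ (EuclideanSpace.single i (1 : ℝ))).comp b) v₀ :=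
      (ContinuousLinearMap.apply ℝ ℝ (EuclideanSpace.single i (1 : ℝ))).hasFDerivAt.comp v₀ e1
    have e3 : (fun v : Model n =>
        fderiv ℝ (fun u : Model n => c (u, v)) u₀ (EuclideanSpace.single i 1)) =ᶠ[𝓝 v₀]
        fun v => D₁ (u₀, v) (EuclideanSpace.single i 1) := by
      have : Tendsto (fun v : Model n => (u₀, v)) (𝓝 v₀) (𝓝 (u₀, v₀)) :=
        (Continuous.prodMk_right u₀).continuousAt
      filter_upwards [this.eventually hdiff] with v hv
      rw [(hpartial (u₀, v) hv).fderiv]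
    rw [e3.fderiv_eq, e2.fderiv]
    rfl
  let A₀ : Model n →ₗ[ℝ] Model n :=
    { toFun := fun v => -(InnerProductSpace.toDual ℝ (Model n)).symm (b v)
      map_add' := fun v w => by simp only [map_add, neg_add]
      map_smul' := fun a v => by simp [smul_neg] }
  have hA₀ : ∀ v u, inner ℝ (A₀ v) u = - b v u := by
    intro v u
    simp [A₀, inner_neg_left]
  have hA₀inj : Function.Injective A₀ := by
    rw [injective_iff_map_eq_zero]
    intro v hv
    have hbv : ∀ u, b v u = 0 := fun u => by
      have := hA₀ v u
      rw [hv, inner_zero_left] at this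
      linarith
    have hsum : v = ∑ j, v j • EuclideanSpace.single j (1 : ℝ) := by
      ext j
      simp [Finset.sum_apply, Pi.single_apply]
    have hmv : (Matrix.of fun i j => fderiv ℝ (fun v : Model n =>
        fderiv ℝ (fun u : Model n => c (u, v)) u₀ (EuclideanSpace.single i 1))
        v₀ (EuclideanSpace.single j (1 : ℝ))).mulVec (WithLp.ofLp v) = 0 := by
      ext i
      have h1 := hbv (EuclideanSpace.single i 1)
      rw [hsum] at h1
      simp only [map_sum, map_smul, sum_apply, smul_apply, smul_eq_mul] at h1
      simp only [Matrix.mulVec, dotProduct, Matrix.of_apply, hentry, Pi.zero_apply]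
      rw [← h1]
      exact Finset.sum_congr rfl fun j _ => mul_comm _ _
    have := Matrix.eq_zero_of_mulVec_eq_zero hdet hmv
    ext i
    exact congrFun this i
  let A : Model n ≃L[ℝ] Model n :=
    (LinearEquiv.ofInjectiveEndo A₀ hA₀inj).toContinuousLinearEquiv
  have hA : ∀ v u, inner ℝ (A v) u = - b v u := hA₀
  set S : ℝ := ‖(A.symm : Model n →L[ℝ] Model n)‖
  have hS0 : 0 ≤ S := norm_nonneg _
  have hAs : ∀ w, ‖w‖ ≤ S * ‖A w‖ := fun w => by
    have := (A.symm : Model n →L[ℝ] Model n).le_opNorm (A w)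
    simpa using this
  -- `ε` is chosen so that `ε * ‖v‖ ≤ ‖A v‖ / 2`
  set ε : ℝ := 1 / (2 * (S + 1)) with hε
  have hε0 : 0 < ε := by positivity
  have hεS : ε * S ≤ 1 / 2 := by
    rw [hε, div_mul_eq_mul_div, one_mul, div_le_div_iff₀ (by positivity) (by norm_num)]
    linarith
  have hclose : ∀ᶠ q : (Model n × Model n) × (Model n × Model n) in 𝓝 ((u₀, v₀), (u₀, v₀)),
      ‖D₁ q.1 - D₁ q.2 - L (q.1 - q.2)‖ ≤ ε * ‖q.1 - q.2‖ := hstrict.isLittleO.def hε0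
  obtain ⟨r₁, hr₁, hball₁⟩ := Metric.eventually_nhds_iff_ball.1 hclose
  obtain ⟨r₂, hr₂, hball₂⟩ := Metric.eventually_nhds_iff_ball.1 hdiff
  refine ⟨A, min r₁ r₂, lt_min hr₁ hr₂, fun u hu u' hu' v hv v' hv' hmono => ?_⟩
  have hmem : ∀ {r : ℝ}, min r₁ r₂ ≤ r → ∀ a ∈ Metric.ball u₀ (min r₁ r₂),
      ∀ w ∈ Metric.ball v₀ (min r₁ r₂), (a, w) ∈ Metric.ball (u₀, v₀) r := by
    intro r hr a ha w hw
    rw [← ball_prod_same]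
    exact ⟨Metric.ball_subset_ball hr ha, Metric.ball_subset_ball hr hw⟩
  -- The mixed difference of `c` is the increment of `a ↦ c (a, v') - c (a, v)`, whose derivative is
  -- close to `b (v' - v)`.
  have hder : ∀ a ∈ Metric.ball u₀ (min r₁ r₂), HasFDerivWithinAt
      (fun a => c (a, v') - c (a, v)) (D₁ (a, v') - D₁ (a, v)) (Metric.ball u₀ (min r₁ r₂)) a := by
    intro a ha
    exact ((hpartial (a, v') (hball₂ _ (hmem (min_le_right _ _) a ha v' hv'))).sub
      (hpartial (a, v) (hball₂ _ (hmem (min_le_right _ _) a ha v hv)))).hasFDerivWithinAt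
  have hbound : ∀ a ∈ Metric.ball u₀ (min r₁ r₂),
      ‖(D₁ (a, v') - D₁ (a, v)) - b (v' - v)‖ ≤ ε * ‖v' - v‖ := by
    intro a ha
    have h1 : (((a, v'), (a, v)) : (Model n × Model n) × (Model n × Model n)) ∈
        Metric.ball (((u₀, v₀), (u₀, v₀)) : (Model n × Model n) × (Model n × Model n)) r₁ := by
      rw [← ball_prod_same]
      exact ⟨hmem (min_le_left _ _) a ha v' hv', hmem (min_le_left _ _) a ha v hv⟩
    have h2 := hball₁ _ h1
    simpa [hb, Prod.norm_def] using h2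
  have hmv := (convex_ball u₀ (min r₁ r₂)).norm_image_sub_le_of_norm_hasFDerivWithin_le' hder
    hbound hu hu'
  have hb1 : b (v' - v) (u' - u) ≤ ε * ‖v' - v‖ * ‖u' - u‖ := by
    rw [Real.norm_eq_abs, abs_le] at hmv
    linarith [hmv.1]
  set p := u' - u
  set w := A (v' - v) with hw
  have hin : -(1 / 2 * ‖w‖ * ‖p‖) ≤ inner ℝ p w := by
    rw [real_inner_comm, hw, hA]
    have h1 : ε * ‖v' - v‖ ≤ 1 / 2 * ‖w‖ := by
      calc ε * ‖v' - v‖ ≤ ε * (S * ‖w‖) := mul_le_mul_of_nonneg_left (hAs _) hε0.le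
        _ = ε * S * ‖w‖ := by ring
        _ ≤ 1 / 2 * ‖w‖ := mul_le_mul_of_nonneg_right hεS (norm_nonneg _)
    have h2 := mul_le_mul_of_nonneg_right h1 (norm_nonneg p)
    linarith
  have hsq : ‖p + w‖ ^ 2 = ‖p‖ ^ 2 + 2 * inner ℝ p w + ‖w‖ ^ 2 := norm_add_sq_real p w
  have hfin : ‖p‖ ≤ 2 * ‖p + w‖ := by
    refine (sq_le_sq₀ (norm_nonneg _) (by positivity)).1 ?_
    nlinarith [sq_nonneg (‖p‖ - 2 * ‖w‖), sq_nonneg ‖p‖]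
  rw [dist_comm u, dist_comm (u + A v), dist_eq_norm, dist_eq_norm]
  have : u' + A v' - (u + A v) = p + w := by
    rw [hw, map_sub]
    exact (add_sub_add_comm u' (A v') u (A v))
  rwa [this]

end Monotone

section Differentiability

variable {n : ℕ} {M N : Type*}
  [TopologicalSpace M] [SecondCountableTopology M] [ChartedSpace (Model n) M]
  [IsManifold (𝓡 n) ∞ M] [MeasurableSpace M] [BorelSpace M]
  [TopologicalSpace N] [ChartedSpace (Model n) N] [IsManifold (𝓡 n) ∞ N]

/-- A continuous map whose graph is monotone with respect to a non-degenerate cost is differentiable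
almost everywhere relative to its domain, which can be any set. -/
theorem ae_mdifferentiableWithinAt_of_monotone (g : Metric n M) {c : M × N → ℝ}
    (hc : ContMDiff ((𝓡 n).prod (𝓡 n)) 𝓘(ℝ, ℝ) 2 c) (hnd : ∀ x y, NondegenerateAt n c x y)
    {T : M → N} {S : Set M} (hT : ContinuousOn T S)
    (hmono : ∀ x ∈ S, ∀ x' ∈ S, c (x, T x) + c (x', T x') ≤ c (x, T x') + c (x', T x)) :
    ∀ᵐ x ∂(riemannianVolume g), x ∈ S → MDifferentiableWithinAt (𝓡 n) (𝓡 n) T S x := by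
  rw [ae_iff]
  refine measure_null_of_locally_null _ fun x₀ hx₀ => ?_
  obtain ⟨hx₀S, -⟩ := Classical.not_imp.1 hx₀
  set φ := chartAt (Model n) x₀
  set ψ := chartAt (Model n) (T x₀)
  have hφ : φ ∈ atlas (Model n) M := chart_mem_atlas _ _
  have hψ : ψ ∈ atlas (Model n) N := chart_mem_atlas _ _
  have hx₀φ : x₀ ∈ φ.source := mem_chart_source _ _
  have hx₀ψ : T x₀ ∈ ψ.source := mem_chart_source _ _
  obtain ⟨A, r, hr, hA⟩ := exists_dist_le_of_nondegenerate
    (contDiffAt_chart hc hφ hψ (φ.map_source hx₀φ) (ψ.map_source hx₀ψ)) (hnd x₀ (T x₀))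
  have hO₁ : φ.source ∩ φ ⁻¹' Metric.ball (φ x₀) r ∈ 𝓝 x₀ :=
    (φ.isOpen_inter_preimage Metric.isOpen_ball).mem_nhds ⟨hx₀φ, Metric.mem_ball_self hr⟩
  have hO₂ : T ⁻¹' (ψ.source ∩ ψ ⁻¹' Metric.ball (ψ (T x₀)) r) ∈ 𝓝[S] x₀ :=
    hT x₀ hx₀S ((ψ.isOpen_inter_preimage Metric.isOpen_ball).mem_nhds
      ⟨hx₀ψ, Metric.mem_ball_self hr⟩)
  obtain ⟨O, hO, hx₀O, hOsub⟩ := mem_nhdsWithin.1 (inter_mem (mem_nhdsWithin_of_mem_nhds hO₁) hO₂)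
  set W := O ∩ S with hW
  have hWφ : W ⊆ φ.source := fun x hx => (hOsub hx).1.1
  have hWψ : MapsTo T W ψ.source := fun x hx => (hOsub hx).2.1
  set t : Model n → Model n := ψ ∘ T ∘ φ.symm with ht
  have htφ : ∀ x ∈ W, t (φ x) = ψ (T x) := fun x hx => by simp [ht, φ.left_inv (hWφ hx)]
  have htc : ContinuousOn t (φ '' W) := by
    have hmaps : MapsTo φ.symm (φ '' W) W := by
      rintro _ ⟨x, hx, rfl⟩
      rwa [φ.left_inv (hWφ hx)]
    have h1 : ContinuousOn φ.symm (φ '' W) := φ.continuousOn_symm.mono (by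
      rintro _ ⟨x, hx, rfl⟩
      exact φ.map_source (hWφ hx))
    exact ψ.continuousOn.comp ((hT.mono inter_subset_right).comp h1 hmaps) (hWψ.comp hmaps)
  have hP := ae_differentiableWithinAt_of_antilipschitz (volume : Measure (Model n))
    (W := φ '' W) (P := fun z => z + A (t z)) (K := 2)
    (continuousOn_id.add (A.continuous.comp_continuousOn htc)) (by
      rintro _ ⟨x, hx, rfl⟩ _ ⟨x', hx', rfl⟩
      rw [htφ x hx, htφ x' hx']
      have hx1 := hOsub hx
      have hx1' := hOsub hx'
      refine hA _ hx1.1.2 _ hx1'.1.2 _ hx1.2.2 _ hx1'.2.2 ?_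
      simp only [φ.left_inv (hWφ hx), φ.left_inv (hWφ hx'), ψ.left_inv (hWψ hx),
        ψ.left_inv (hWψ hx')]
      exact hmono x hx.2 x' hx'.2)
  have htd : ∀ᵐ z, z ∈ φ '' W → DifferentiableWithinAt ℝ t (φ '' W) z := by
    filter_upwards [hP] with z hz hzW
    have h1 : t = fun z => A.symm ((z + A (t z)) - z) := by
      funext z; simp
    rw [h1]
    exact A.symm.differentiable.differentiableAt.comp_differentiableWithinAt z
      ((hz hzW).sub differentiableWithinAt_id)
  refine ⟨W ∩ {x | ¬(x ∈ S → MDifferentiableWithinAt (𝓡 n) (𝓡 n) T S x)}, ?_, ?_⟩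
  · refine inter_mem ?_ self_mem_nhdsWithin
    refine inter_mem (mem_nhdsWithin_of_mem_nhds (hO.mem_nhds hx₀O)) ?_
    exact mem_of_superset self_mem_nhdsWithin fun x hx => (Classical.not_imp.1 hx).1
  · refine riemannianVolume_eq_zero_of_image g hφ (inter_subset_left.trans hWφ)
      (measure_mono_null ?_ (ae_iff.1 htd))
    rintro _ ⟨x, ⟨hxW, hx⟩, rfl⟩ hd
    refine hx fun _ => ?_
    have h1 := mdifferentiableWithinAt_of_chart hφ hψ hWφ hWψ hxW (hd (mem_image_of_mem φ hxW))
    rw [hW, inter_comm] at h1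
    exact (mdifferentiableWithinAt_inter (hO.mem_nhds hxW.1)).1 h1

end Differentiability

/-! ### The Jacobian equation -/

section Jacobian

variable {n : ℕ} {M N : Type*}
  [TopologicalSpace M] [ChartedSpace (Model n) M] [IsManifold (𝓡 n) ∞ M]
  [TopologicalSpace N] [ChartedSpace (Model n) N] [IsManifold (𝓡 n) ∞ N]

/-- The Jacobian equation in coordinates, with the densities `√(det g_ij)` and `√(det h_ij)`,
implies the invariant one: the differentials of the charts contribute the same factor to both sides. -/
theorem eq_absDet_mul_of_chart (g : Metric n M) (h : Metric n N)
    {φ : OpenPartialHomeomorph M (Model n)} (hφ : φ ∈ atlas (Model n) M)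
    {ψ : OpenPartialHomeomorph N (Model n)} (hψ : ψ ∈ atlas (Model n) N)
    {z : Model n} (hz : z ∈ φ.target) {y : N} (hy : y ∈ ψ.source)
    (A : TangentSpace (𝓡 n) (φ.symm z) →L[ℝ] TangentSpace (𝓡 n) y)
    {t' : Model n →L[ℝ] Model n}
    (ht' : t' = (mfderiv (𝓡 n) (𝓡 n) ψ y).comp (A.comp (mfderiv (𝓡 n) (𝓡 n) φ.symm z)))
    {a b : ℝ≥0}
    (hab : chartDensity g φ z * a = ENNReal.ofReal |t'.det| * (chartDensity h ψ (ψ y) * b)) :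
    (a : ℝ) = absDet g h (φ.symm z) y A * b := by
  let Φ : Model n →L[ℝ] Model n := mfderiv (𝓡 n) (𝓡 n) φ.symm z
  let Ψ : Model n →L[ℝ] Model n := mfderiv (𝓡 n) (𝓡 n) ψ.symm (ψ y)
  let Ψ' : Model n →L[ℝ] Model n := mfderiv (𝓡 n) (𝓡 n) ψ y
  let A' : Model n →L[ℝ] Model n := A
  have hΨ : Ψ.comp Ψ' = ContinuousLinearMap.id ℝ (Model n) :=
    (mdifferentiable_of_mem_atlas (I := 𝓡 n) hψ).symm_comp_deriv hy
  have hΨt : Ψ.comp t' = A'.comp Φ := by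
    have h1 : t' = Ψ'.comp (A'.comp Φ) := ht'
    rw [h1, ← ContinuousLinearMap.comp_assoc, hΨ, ContinuousLinearMap.id_comp]
  set e : Fin n → Model n := fun i => EuclideanSpace.single i (1 : ℝ)
  set G := parallelepipedVolume g (φ.symm z) (basisVector (φ.symm z))
  set H := parallelepipedVolume h y (fun i => A (basisVector (φ.symm z) i))
  have hG0 : 0 < G := parallelepipedVolume_pos g (φ.symm z)
    (ContinuousLinearMap.id ℝ (Model n)) Function.injective_id
  have hH0 : 0 ≤ H := Real.sqrt_nonneg _
  have e1 : parallelepipedVolume g (φ.symm z) (coordVector φ z) = |Φ.det| * G :=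
    parallelepipedVolume_comp g (φ.symm z) (ContinuousLinearMap.id ℝ (Model n)) Φ
  have hcast : ∀ y' : N, y' = y → ∀ v : Fin n → Model n,
      parallelepipedVolume h y' v = parallelepipedVolume h y v := by
    rintro y' rfl v; rfl
  have e2 : parallelepipedVolume h (ψ.symm (ψ y)) (coordVector ψ (ψ y)) =
      parallelepipedVolume h y (fun i => Ψ (e i)) := hcast _ (ψ.left_inv hy) _
  have e3 : parallelepipedVolume h y (fun i => Ψ (t' (e i))) =
      |t'.det| * parallelepipedVolume h y (fun i => Ψ (e i)) :=
    parallelepipedVolume_comp h y Ψ t'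
  have e4 : parallelepipedVolume h y (fun i => Ψ (t' (e i))) =
      parallelepipedVolume h y (fun i => A' (Φ (e i))) :=
    congrArg (fun B : Model n →L[ℝ] Model n => parallelepipedVolume h y (fun i => B (e i))) hΨt
  have e5 : parallelepipedVolume h y (fun i => A' (Φ (e i))) = |Φ.det| * H :=
    parallelepipedVolume_comp h y A' Φ
  have hpos : 0 < |Φ.det| * G := by
    rw [← e1]
    exact ENNReal.ofReal_pos.1 (pos_iff_ne_zero.2 (chartDensity_ne_zero g hφ hz))
  have hΦ : 0 < |Φ.det| := pos_of_mul_pos_left hpos hG0.le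
  have key : |Φ.det| * G * a = |Φ.det| * H * b := by
    unfold chartDensity at hab
    rw [← mul_assoc, ← ENNReal.ofReal_mul (abs_nonneg _), e1, e2, ← e3, e4, e5,
      ← ENNReal.ofReal_coe_nnreal, ← ENNReal.ofReal_coe_nnreal,
      ← ENNReal.ofReal_mul hpos.le, ← ENNReal.ofReal_mul (mul_nonneg hΦ.le hH0)] at hab
    exact (ENNReal.ofReal_eq_ofReal_iff (mul_nonneg hpos.le a.2)
      (mul_nonneg (mul_nonneg hΦ.le hH0) b.2)).1 hab
  have key' : G * a = H * b := by
    rw [mul_assoc, mul_assoc] at key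
    exact mul_left_cancel₀ hΦ.ne' key
  change (a : ℝ) = H / G * b
  rw [div_mul_eq_mul_div, eq_div_iff hG0.ne', ← key', mul_comm]

variable [SecondCountableTopology M] [MeasurableSpace M] [BorelSpace M]
  [SecondCountableTopology N] [MeasurableSpace N] [BorelSpace N]

/-- The Jacobian equation for an injective map `T` that transports `μ` to `ν` on a Borel set `W₀`,
at the points of `W₀` where `T` is differentiable relative to a set `W ⊇ W₀`, which need not be
measurable. -/
theorem ae_jacobian (g : Metric n M) (h : Metric n N) {μ : Measure M} {ν : Measure N}
    [IsFiniteMeasure μ] {f₁ : M → ℝ≥0} {f₂ : N → ℝ≥0}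
    (hf₁ : AEMeasurable f₁ (riemannianVolume g)) (hf₂ : AEMeasurable f₂ (riemannianVolume h))
    (hμ : μ = (riemannianVolume g).withDensity (fun x => (f₁ x : ℝ≥0∞)))
    (hν : ν = (riemannianVolume h).withDensity (fun y => (f₂ y : ℝ≥0∞)))
    {T : M → N} {W₀ W : Set M} (hW₀ : MeasurableSet W₀) (hW₀W : W₀ ⊆ W) (hTinj : InjOn T W₀)
    (hTcont : ContinuousOn T W₀)
    (hpush : ∀ A ⊆ W₀, MeasurableSet A → MeasurableSet (T '' A) → μ A = ν (T '' A)) :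
    ∀ᵐ x ∂(riemannianVolume g), x ∈ W₀ → MDifferentiableWithinAt (𝓡 n) (𝓡 n) T W x →
      UniqueMDiffWithinAt (𝓡 n) W x ∧
      (f₁ x : ℝ) = absDet g h x (T x) (mfderivWithin (𝓡 n) (𝓡 n) T W x) * f₂ (T x) := by
  rw [ae_iff]
  set bad : Set M := {x | ¬(x ∈ W₀ → MDifferentiableWithinAt (𝓡 n) (𝓡 n) T W x →
      UniqueMDiffWithinAt (𝓡 n) W x ∧
      (f₁ x : ℝ) = absDet g h x (T x) (mfderivWithin (𝓡 n) (𝓡 n) T W x) * f₂ (T x))}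
  have hbadW : bad ⊆ W₀ := fun x hx => (Classical.not_imp.1 hx).1
  refine measure_null_of_locally_null _ fun x₀ hx₀ => ?_
  have hx₀W := hbadW hx₀
  set φ := chartAt (Model n) x₀
  set ψ := chartAt (Model n) (T x₀)
  have hφ : φ ∈ atlas (Model n) M := chart_mem_atlas _ _
  have hψ : ψ ∈ atlas (Model n) N := chart_mem_atlas _ _
  have hx₀φ : x₀ ∈ φ.source := mem_chart_source _ _
  have hx₀ψ : T x₀ ∈ ψ.source := mem_chart_source _ _
  obtain ⟨O, hO, hx₀O, hOsub⟩ := mem_nhdsWithin.1 (inter_mem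
    (mem_nhdsWithin_of_mem_nhds (φ.open_source.mem_nhds hx₀φ))
    (hTcont x₀ hx₀W (ψ.open_source.mem_nhds hx₀ψ)))
  set W₁ := O ∩ W₀ with hW₁
  have hW₁m : MeasurableSet W₁ := hO.measurableSet.inter hW₀
  have hW₁φ : W₁ ⊆ φ.source := fun x hx => (hOsub hx).1
  have hW₁ψ : MapsTo T W₁ ψ.source := fun x hx => (hOsub hx).2
  set t : Model n → Model n := ψ ∘ T ∘ φ.symm with ht
  have hVmaps : MapsTo φ.symm (φ '' W₁) W₁ := by
    rintro _ ⟨x, hx, rfl⟩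
    rwa [φ.left_inv (hW₁φ hx)]
  have hVtarget : φ '' W₁ ⊆ φ.target := by
    rintro _ ⟨x, hx, rfl⟩
    exact φ.map_source (hW₁φ hx)
  have hVm : MeasurableSet (φ '' W₁) := measurableSet_image φ hW₁m hW₁φ
  have htc : ContinuousOn t (φ '' W₁) :=
    ψ.continuousOn.comp ((hTcont.mono inter_subset_right).comp
      (φ.continuousOn_symm.mono hVtarget) hVmaps) (hW₁ψ.comp hVmaps)
  have htinj : InjOn t (φ '' W₁) := by
    intro z hz w hw hzw
    exact φ.symm.injOn (hVtarget hz) (hVtarget hw) (hTinj (hVmaps hz).2 (hVmaps hw).2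
      (ψ.injOn (hW₁ψ (hVmaps hz)) (hW₁ψ (hVmaps hw)) hzw))
  have htψ : MapsTo t (φ '' W₁) ψ.target := fun z hz => ψ.map_source (hW₁ψ (hVmaps hz))
  have hF₁m : AEMeasurable (fun z => chartDensity g φ z * (f₁ (φ.symm z) : ℝ≥0∞))
      (volume.restrict φ.target) :=
    (aemeasurable_chartDensity g hφ).mul (aemeasurable_comp_symm g hφ hf₁.coe_nnreal_ennreal)
  have hF₂m : AEMeasurable (fun w => chartDensity h ψ w * (f₂ (ψ.symm w) : ℝ≥0∞))
      (volume.restrict ψ.target) :=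
    (aemeasurable_chartDensity h hψ).mul (aemeasurable_comp_symm h hψ hf₂.coe_nnreal_ennreal)
  obtain ⟨Q, hQm, hQV, hQcover, hQlip⟩ := exists_lipschitz_cover hVm htc
  -- `T` is Lipschitz on `Q k` in coordinates, so the change of variables formula applies after
  -- removal of a null set `Z`.
  have hQ : ∀ k, ∀ᵐ z, z ∈ Q k → φ.symm z ∉ bad := by
    intro k
    obtain ⟨K, hK⟩ := hQlip k
    obtain ⟨Z, hZ, hZm, hZ0⟩ := exists_measurable_superset_of_null
      (ae_iff.1 (hK.ae_differentiableWithinAt_of_mem (μ := volume)))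
    set C := Q k \ Z
    have hCm : MeasurableSet C := (hQm k).diff hZm
    have hCV : C ⊆ φ '' W₁ := sdiff_subset.trans (hQV k)
    have hCd : ∀ z ∈ C, HasFDerivWithinAt t (fderivWithin ℝ t (Q k) z) C z := by
      intro z hz
      have : DifferentiableWithinAt ℝ t (Q k) z := by
        by_contra hd
        exact hz.2 (hZ fun h' => hd (h' hz.1))
      exact this.hasFDerivWithinAt.mono sdiff_subset
    have hintμ : ∀ A ⊆ C, MeasurableSet A →
        ∫⁻ z in A, chartDensity g φ z * (f₁ (φ.symm z) : ℝ≥0∞) = μ (φ.symm '' A) := by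
      intro A hAC hA
      rw [hμ, withDensity_symm_image g hφ hf₁.coe_nnreal_ennreal hA
        ((hAC.trans hCV).trans hVtarget)]
    have hdens := ae_density_eq_of_image volume hCm ψ.open_target.measurableSet hCd
      (htinj.mono hCV) (htψ.mono_left hCV)
      (hF₁m.mono_measure (Measure.restrict_mono (hCV.trans hVtarget) le_rfl)) hF₂m
      (by rw [hintμ C subset_rfl hCm]; exact measure_ne_top _ _)
      (by
        intro A hAC hA
        have hAV := hAC.trans hCV
        have htA : MeasurableSet (t '' A) := measurable_image_of_fderivWithin hA
          (fun z hz => (hCd z (hAC hz)).mono hAC) (htinj.mono hAV)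
        have htAψ : t '' A ⊆ ψ.target := (htψ.mono_left hAV).image_subset
        have himg : T '' (φ.symm '' A) = ψ.symm '' (t '' A) := by
          rw [image_image, image_image]
          refine image_congr fun z hz => ?_
          exact (ψ.left_inv (hW₁ψ (hVmaps (hAV hz)))).symm
        rw [hintμ A hAC hA, hpush (φ.symm '' A)
          ((hVmaps.mono_left hAV).image_subset.trans inter_subset_right)
          (measurableSet_symm_image φ hA (hAV.trans hVtarget))
          (himg ▸ measurableSet_symm_image ψ htA htAψ), himg, hν,
          withDensity_symm_image h hψ hf₂.coe_nnreal_ennreal htA htAψ])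
    filter_upwards [hdens, ae_uniqueDiffWithinAt volume C,
      measure_eq_zero_iff_ae_notMem.1 hZ0] with z h1 h2 h3 hzQ
    have hzC : z ∈ C := ⟨hzQ, h3⟩
    have hzV := hCV hzC
    have hzφ := hVtarget hzV
    refine fun hb => hb fun _ hTd => ?_
    have hCW : MapsTo φ.symm C W := fun w hw => hW₀W (hVmaps (hCV hw)).2
    constructor
    · have hun : UniqueMDiffWithinAt (𝓡 n) C z :=
        uniqueMDiffWithinAt_iff_uniqueDiffWithinAt.2 (h2 hzC)
      have hme := (mdifferentiable_of_mem_atlas (I := 𝓡 n) hφ).symm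
      exact (hun.image_denseRange
        (mdifferentiableAt_atlas_symm hφ hzφ).hasMFDerivAt.hasMFDerivWithinAt
        (hme.mfderiv_surjective hzφ).denseRange).mono hCW.image_subset
    · have hψz : T (φ.symm z) ∈ ψ.source := hW₁ψ (hVmaps hzV)
      have hfd := hasFDerivWithinAt_chart hφ hψ hCW hzφ hψz hTd.hasMFDerivWithinAt
      have h4 := h1 hzC
      have h5 : ψ.symm (t z) = T (φ.symm z) := ψ.left_inv hψz
      simp only [h5] at h4
      exact eq_absDet_mul_of_chart g h hφ hψ hzφ hψz _ ((h2 hzC).eq (hCd z hzC) hfd) h4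
  refine ⟨W₁ ∩ bad, inter_mem (inter_mem (mem_nhdsWithin_of_mem_nhds (hO.mem_nhds hx₀O))
    (mem_of_superset self_mem_nhdsWithin hbadW)) self_mem_nhdsWithin, ?_⟩
  refine riemannianVolume_eq_zero_of_image g hφ (inter_subset_left.trans hW₁φ)
    (measure_mono_null ?_ (ae_iff.1 (ae_all_iff.2 hQ)))
  rintro _ ⟨x, ⟨hxW, hx⟩, rfl⟩ hgood
  have hxV := mem_image_of_mem φ hxW
  have hxφ := hVtarget hxV
  have hxx : φ.symm (φ x) = x := φ.left_inv (hW₁φ hxW)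
  have hTd : MDifferentiableWithinAt (𝓡 n) (𝓡 n) T W (φ.symm (φ x)) := by
    rw [hxx]
    exact (Classical.not_imp.1 (Classical.not_imp.1 hx).2).1
  have hfd := hasFDerivWithinAt_chart hφ hψ (hVmaps.mono_right (fun y hy => hW₀W hy.2)) hxφ
    (hW₁ψ (hVmaps hxV)) hTd.hasMFDerivWithinAt
  obtain ⟨k, hk⟩ := mem_iUnion.1 (hQcover ⟨hxV, hfd.differentiableWithinAt⟩)
  exact hgood k hk (by rwa [hxx])

end Jacobian

end OptimalTransport

theorem proposition4p1 {n : ℕ}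
    {M N : Type*}
    [TopologicalSpace M] [T2Space M] [SecondCountableTopology M]
    [ChartedSpace (OptimalTransport.Model n) M] [IsManifold (𝓡 n) ∞ M]
    [MeasurableSpace M] [BorelSpace M]
    [TopologicalSpace N] [T2Space N] [SecondCountableTopology N]
    [ChartedSpace (OptimalTransport.Model n) N] [IsManifold (𝓡 n) ∞ N]
    [MeasurableSpace N] [BorelSpace N]
    -- Riemannian metrics; "volume" and "det DT" refer to them
    (g : OptimalTransport.Metric n M) (h : OptimalTransport.Metric n N)
    -- the cost
    (c : M × N → ℝ) (hc : ContMDiff ((𝓡 n).prod (𝓡 n)) 𝓘(ℝ, ℝ) 2 c)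
    (hnd : ∀ x y, OptimalTransport.NondegenerateAt n c x y)
    -- the marginals and their densities
    (μ : Measure M) (ν : Measure N) [IsProbabilityMeasure μ] [IsProbabilityMeasure ν]
    (f₁ : M → ℝ≥0) (f₂ : N → ℝ≥0)
    (hf₁ : AEMeasurable f₁ (OptimalTransport.riemannianVolume g))
    (hf₂ : AEMeasurable f₂ (OptimalTransport.riemannianVolume h))
    (hμ : μ = (OptimalTransport.riemannianVolume g).withDensity (fun x => (f₁ x : ℝ≥0∞)))
    (hν : ν = (OptimalTransport.riemannianVolume h).withDensity (fun y => (f₂ y : ℝ≥0∞)))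
    -- the optimizer
    (γ : Measure (M × N)) (hγ : OptimalTransport.IsOptimal c μ ν γ)
    -- the map; only its values on `D = dom(T)` matter
    (D : Set M) (hD : OptimalTransport.riemannianVolume g Dᶜ = 0)
    (T : M → N) (hTinj : InjOn T D) (hTcont : ContinuousOn T D)
    (hgraph : ∀ᵐ p ∂γ, p.1 ∈ D ∧ p.2 = T p.1) :
    -- `T`, restricted to `dom(T) ∩ spt μ`, is differentiable and solves the Jacobian equation
    -- almost everywhere on `spt μ`
    (∀ᵐ x ∂(OptimalTransport.riemannianVolume g), x ∈ μ.support →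
      UniqueMDiffWithinAt (𝓡 n) (D ∩ μ.support) x ∧
      MDifferentiableWithinAt (𝓡 n) (𝓡 n) T (D ∩ μ.support) x ∧
      (f₁ x : ℝ) =
        OptimalTransport.absDet g h x (T x)
          (mfderivWithin (𝓡 n) (𝓡 n) T (D ∩ μ.support) x) * f₂ (T x)) ∧
    -- the Jacobian equation also holds almost everywhere where `T : dom(T) → N` is differentiable
    (∀ᵐ x ∂(OptimalTransport.riemannianVolume g),
      MDifferentiableWithinAt (𝓡 n) (𝓡 n) T D x →
      UniqueMDiffWithinAt (𝓡 n) D x ∧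
      (f₁ x : ℝ) =
        OptimalTransport.absDet g h x (T x) (mfderivWithin (𝓡 n) (𝓡 n) T D x) * f₂ (T x)) := by
  have hpush := fun A => hγ.coupling.measure_image_eq hTinj hgraph (A := A)
  -- a Borel set of full volume inside `D`
  set D' : Set M := (toMeasurable (OptimalTransport.riemannianVolume g) Dᶜ)ᶜ with hD'
  have hD'm : MeasurableSet D' := (measurableSet_toMeasurable _ _).compl
  have hD'D : D' ⊆ D := compl_subset_comm.1 (subset_toMeasurable _ _)
  have hD'ae : ∀ᵐ x ∂(OptimalTransport.riemannianVolume g), x ∈ D' := by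
    rw [ae_iff, hD']
    change OptimalTransport.riemannianVolume g (toMeasurable _ Dᶜ)ᶜᶜ = 0
    rw [compl_compl, measure_toMeasurable, hD]
  have hsupp : MeasurableSet μ.support := Measure.isClosed_support.measurableSet
  constructor
  · have hdiff := OptimalTransport.ae_mdifferentiableWithinAt_of_monotone g hc hnd
      (hTcont.mono (inter_subset_left (t := μ.support))) fun x hx x' hx' =>
        hγ.two_monotone hc.continuous
          (hγ.coupling.mem_support_of_graph hTcont hgraph hx.1 hx.2)
          (hγ.coupling.mem_support_of_graph hTcont hgraph hx'.1 hx'.2)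
    have hsub : D' ∩ μ.support ⊆ D := inter_subset_left.trans hD'D
    have hjac := OptimalTransport.ae_jacobian g h hf₁ hf₂ hμ hν (hD'm.inter hsupp)
      (inter_subset_inter_left μ.support hD'D) (hTinj.mono hsub) (hTcont.mono hsub)
      fun A hA => hpush A (hA.trans hsub)
    filter_upwards [hD'ae, hdiff, hjac] with x hx h1 h2 hxs
    have h3 := h1 ⟨hD'D hx, hxs⟩
    obtain ⟨h4, h5⟩ := h2 ⟨hx, hxs⟩ h3
    exact ⟨h4, h3, h5⟩
  · have hjac := OptimalTransport.ae_jacobian g h hf₁ hf₂ hμ hν hD'm hD'D (hTinj.mono hD'D)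
      (hTcont.mono hD'D) fun A hA => hpush A (hA.trans hD'D)
    filter_upwards [hD'ae, hjac] with x hx h1 h2 using h1 hx h2
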